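/- All graphs are finite and connected; loops and parallel edges are allowed unless the graph is said to be simple. An edge consists of two opposite arcs $e$ and $e^R$. A plane graph $G$ is given by its combinatorial embedding (the counterclockwise cyclic order of the arcs around each vertex; planarity means that Euler's formula holds). In its dual graph $G^*$, whose vertices are the faces of $G$, the dual arc of an arc $e$ crosses $e$ from left to right, leading from the face left of $e$ to the face right of $e$. We fix the natural simultaneous embedding of $G$ and $G^*$ in the plane, in which each dual edge meets $G$ exactly once, at a crossing with its edge; each face of $G^*$, including the unbounded one, then contains exactly one vertex of $G$. A closed walk $\gamma$ in $G^*$ with at least one arc is *non-crossing* if some infinitesimal perturbation $\gamma_\varepsilon$ of it is a simple closed curve. Then $V_{\mathrm{int}}(\gamma,G)$ is the set of vertices of $G$ in the bounded component of $\mathbb R^2\setminus\gamma_\varepsilon$, and $\gamma$ is *clockwise* if the unbounded component lies to the left of $\gamma_\varepsilon$. The model of computation is a real RAM: a random access machine with unit-cost instructions for moving, adding, subtracting and comparing natural numbers, indirect addressing, and moving, adding and subtracting real numbers. **Theorem.** There are a fixed preprocessing algorithm and a fixed query algorithm with the following property. Let $G$ be a connected plane graph with $n$ vertices and vertex weights $\omega\colon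 V(G)\to\mathbb R$, let $x_0$ be a vertex of $G$, and let $\Pi=\{\pi_1,\dots,\pi_\ell\}$ be a finite family of walks in $G^*$, each with at least one arc, with a total of $m$ arcs, counted with multiplicity. Given $G$, $\omega$, $x_0$ and $\Pi$, the preprocessing takes $O(n+|E(G)|+m)$ time, which is $O(n+m)$ if $G$ is simple. Afterwards, any sequence of queries of the following type can be answered: given a clockwise non-crossing closed walk $\gamma$ in $G^*$ with $x_0\in V_{\mathrm{int}}(\gamma,G)$, described as the concatenation of $k$ nonempty subpaths of walks of $\Pi$ (each subpath is specified by the index of the walk and the indices of its first and its last arc), return $$\sigma(V_{\mathrm{int}}(\gamma,G))=\sum_{x\in V_{\mathrm{int}}(\gamma,G)}\omega(x)$$ in $O(k)$ time. The result does not depend on the perturbation used: it is the total weight of the vertices in the interior of $\gamma_\varepsilon$ for every simple perturbation $\gamma_\varepsilon$ for which $\gamma_\varepsilon$ is clockwise and has $x_0$ in its interior. The constants in the $O(\cdot)$ are absolute. -/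

import Mathlib

/-! ### Plane graphs, given by a combinatorial embedding

An undirected edge is a pair of opposite arcs (*darts*) `d` and `rev d`.  Loops and parallel edges
are allowed.  The graph is connected. -/

/-- A connected plane graph with vertex set `Fin n` and dart set `Fin D` (so it has `D / 2` edges).
The head of `d` is `tail (rev d)`. -/
structure PlaneGraph (n D : ℕ) where
  /-- the tail of a dart -/
  tail : Fin D → Fin n
  /-- the reversal of a dart -/
  rev : Fin D → Fin D
  /-- the next dart in counterclockwise order around the tail -/
  rot : Equiv.Perm (Fin D)
  rev_rev : ∀ d, rev (rev d) = d
  rev_ne : ∀ d, rev d ≠ d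
  /-- the darts with a given tail form one cyclic order -/
  sameCycle_rot_iff : ∀ d e, rot.SameCycle d e ↔ tail d = tail e
  connected : ∀ u v : Fin n,
    Relation.ReflTransGen (fun a b => ∃ d, tail d = a ∧ tail (rev d) = b) u v
  /-- Euler's formula `n - D / 2 + #faces = 2`, where a face is a cycle of the permutation that
  sends a dart `d` to the next dart along the face to the left of `d`: at the head of `d`, this is
  the clockwise successor of `rev d`.  (A graph without edges is one vertex, and is planar.) -/
  euler : 0 < D → 2 * n +
    2 * Nat.card (Quotient (Equiv.Perm.SameCycle.setoid
      (Equiv.trans (Function.Involutive.toPerm rev rev_rev) rot.symm))) = D + 4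
  /-- The position of the point at infinity: in the natural simultaneous embedding of the graph and
  its dual in the plane, every face of the dual contains exactly one vertex; `vInf` is the vertex in
  the unbounded face of the dual (in particular it is incident with the outer face). -/
  vInf : Fin n

namespace PlaneGraph

variable {n D : ℕ} (G : PlaneGraph n D)

/-- No loops and no parallel edges. -/
def IsSimple : Prop :=
  (∀ d, G.tail d ≠ G.tail (G.rev d)) ∧
  ∀ d e, G.tail d = G.tail e → G.tail (G.rev d) = G.tail (G.rev e) → d = e

/-- The next dart along the face to the left of a dart. The faces are the cycles of this
permutation; the face to the left of a dart is the cycle of the dart. -/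
def facePerm : Equiv.Perm (Fin D) :=
  Equiv.trans (Function.Involutive.toPerm G.rev G.rev_rev) G.rot.symm

/-- `d` and `e` have the same face on their left. -/
def SameFace (d e : Fin D) : Prop := G.facePerm.SameCycle d e

/-! Each dart `d` stands also for its dual arc, the arc of the dual graph that crosses `d`
from left to right: it leads from the face left of `d` to the face right of `d`, and the latter
is the face left of `rev d`. The dual arc of `rev d` is the reversal of the dual arc of `d`. -/

/-- A walk in the dual graph with at least one arc, as its list of dual arcs. -/
def IsDualWalk (π : List (Fin D)) : Prop :=
  π ≠ [] ∧ π.IsChain (fun d e => G.SameFace (G.rev d) e)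

/-- A closed walk in the dual graph (with at least one arc); `finRotate` is the cyclic successor. -/
def IsClosedDualWalk (γ : List (Fin D)) : Prop :=
  γ ≠ [] ∧ ∀ i : Fin γ.length, G.SameFace (G.rev (γ.get i)) (γ.get (finRotate _ i))

/-! ### Infinitesimal perturbations of closed dual walks

A perturbation `γ_ε` of a closed dual walk `γ` crosses the edges of `G` in the same order as `γ`,
with slightly moved crossing points, and between two consecutive crossings it runs through the
interior of a face, which (on the sphere) is a disc. It is described by the order in
which the crossings appear along each edge, given by integer positions: `pos i` is the
position of the `i`-th crossing along the dart `γ.get i`, so `-pos i` is the position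
along the reversed dart. -/

/-- The `i`-th arc of `γ` crosses the edge of `d` (in any direction). -/
def Crosses (γ : List (Fin D)) (d : Fin D) (i : Fin γ.length) : Prop :=
  γ.get i = d ∨ γ.get i = G.rev d

/-- The position of the `i`-th crossing along `d`, from the tail to the head of `d`
(used only for `d` with `G.Crosses γ d i`). -/
def coord (γ : List (Fin D)) (pos : Fin γ.length → ℤ) (d : Fin D) (i : Fin γ.length) : ℤ :=
  if γ.get i = d then pos i else -pos i

/-- The number of steps along the face boundary from the dart `r` to the dart `d`
(used only for `d` on the same face as `r`). -/
noncomputable def rank (r d : Fin D) : ℕ := sInf {k : ℕ | (⇑G.facePerm)^[k] r = d}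

/-- The place of the crossing `i`, as a point of `d`, in the counterclockwise order of the boundary
of the face left of `d`, when the boundary is traversed once from the tail of the dart `r`. -/
noncomputable def place (γ : List (Fin D)) (pos : Fin γ.length → ℤ) (r d : Fin D)
    (i : Fin γ.length) : ℕ ×ₗ ℤ :=
  toLex (G.rank r d, coord γ pos d i)

/-- The pairs `{a, a'}` and `{b, b'}` are interlaced: exactly one of `b`, `b'`
lies strictly between `a` and `a'`. -/
def Interlaced {α : Type*} [LinearOrder α] (a a' b b' : α) : Prop :=
  Xor (min a a' < b ∧ b < max a a') (min a a' < b' ∧ b' < max a a')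

/-- The perturbation of `γ` described by `pos` is a simple closed curve: crossings of the same
edge are at distinct points, and the pieces of the curve inside a face do not cross. The piece after
the `i`-th crossing runs in the face to the left of `rev (γ i)` from the `i`-th crossing, a
point of `rev (γ i)`, to the `(i+1)`-st crossing, a point of `γ (i+1)`. Two pieces in a disc can be
drawn disjointly exactly if their ends are not interlaced on the boundary.

A closed dual walk `γ` is *non-crossing* if it has such a perturbation. -/
def IsSimplePerturbation (γ : List (Fin D)) (pos : Fin γ.length → ℤ) : Prop :=
  (∀ d i j, G.Crosses γ d i → G.Crosses γ d j → i ≠ j → coord γ pos d i ≠ coord γ pos d j) ∧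
  ∀ r i j, i ≠ j → G.SameFace r (G.rev (γ.get i)) → G.SameFace r (G.rev (γ.get j)) →
    ¬ Interlaced
      (G.place γ pos r (G.rev (γ.get i)) i)
      (G.place γ pos r (γ.get (finRotate _ i)) (finRotate _ i))
      (G.place γ pos r (G.rev (γ.get j)) j)
      (G.place γ pos r (γ.get (finRotate _ j)) (finRotate _ j))

/-- `u` and `v` are joined by a path of `G` none of whose edges is crossed by `γ`. -/
def JoinedOff (γ : List (Fin D)) (u v : Fin n) : Prop :=
  Relation.ReflTransGen
    (fun a b => ∃ d, G.tail d = a ∧ G.tail (G.rev d) = b ∧ ∀ i, ¬ G.Crosses γ d i) u v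

/-- `i` is the first crossing met when `d` is traversed from its tail to its head. -/
def IsFirstCrossing (γ : List (Fin D)) (pos : Fin γ.length → ℤ) (d : Fin D) (i : Fin γ.length) :
    Prop :=
  G.Crosses γ d i ∧ ∀ j, G.Crosses γ d j → coord γ pos d i ≤ coord γ pos d j

/-- The vertex `z` lies in the region to the right of `γ_ε`: some curve along edges of `G` starts at
`z` and meets `γ_ε` for the first time coming from the right side of `γ_ε`. (The tail of a dart lies
to the right of the dual arc of that dart.) -/
def RightOf (γ : List (Fin D)) (pos : Fin γ.length → ℤ) (z : Fin n) : Prop :=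
  ∃ d i, G.JoinedOff γ z (G.tail d) ∧ G.IsFirstCrossing γ pos d i ∧ γ.get i = d

/-- The vertex `z` lies in the region to the left of `γ_ε`. -/
def LeftOf (γ : List (Fin D)) (pos : Fin γ.length → ℤ) (z : Fin n) : Prop :=
  ∃ d i, G.JoinedOff γ z (G.tail d) ∧ G.IsFirstCrossing γ pos d i ∧ γ.get i = G.rev d

/-- `γ` is traversed clockwise: the unbounded region lies to its left. -/
def IsClockwise (γ : List (Fin D)) (pos : Fin γ.length → ℤ) : Prop :=
  G.LeftOf γ pos G.vInf

/-- The vertices of `G` in the interior of `γ_ε`: those that `γ_ε` separates from infinity. -/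
def interior (γ : List (Fin D)) (pos : Fin γ.length → ℤ) : Set (Fin n) :=
  {z | (G.RightOf γ pos z ∧ G.LeftOf γ pos G.vInf) ∨
    (G.LeftOf γ pos z ∧ G.RightOf γ pos G.vInf)}

/-- The input of the preprocessing: `n`, `D`, `x₀`, the number of walks; the tails, the reversals
and the counterclockwise successors of the darts; each walk, preceded by its length.
(The weights are given separately, as an array of real numbers.) -/
def encode (x₀ : Fin n) (walks : List (List (Fin D))) : List ℕ :=
  [n, D, (x₀ : ℕ), walks.length] ++
  List.ofFn (fun d => (G.tail d : ℕ)) ++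
  List.ofFn (fun d => (G.rev d : ℕ)) ++
  List.ofFn (fun d => (G.rot d : ℕ)) ++
  walks.flatMap (fun π => π.length :: π.map (fun d => (d : ℕ)))

end PlaneGraph

/-- The total weight of a set of vertices. -/
noncomputable def totalWeight {n : ℕ} (ω : Fin n → ℝ) (U : Set (Fin n)) : ℝ :=
  ∑ x, U.indicator ω x

/-! ### Subpaths of the given walks -/

/-- The reference to a subpath of one of the given walks: the index of the walk,
and the indices of the first and of the last arc of the subpath in it (all counted from 0). -/
structure Subpath where
  walk : ℕ
  first : ℕ
  last : ℕ

namespace Subpath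

/-- The reference is valid. -/
def Valid {D : ℕ} (walks : List (List (Fin D))) (p : Subpath) : Prop :=
  p.first ≤ p.last ∧ p.last < (walks.getD p.walk []).length

/-- The arcs of the subpath. -/
def arcs {D : ℕ} (walks : List (List (Fin D))) (p : Subpath) : List (Fin D) :=
  ((walks.getD p.walk []).drop p.first).take (p.last + 1 - p.first)

/-- The concatenation of subpaths. -/
def concat {D : ℕ} (walks : List (List (Fin D))) (q : List Subpath) : List (Fin D) :=
  q.flatMap (arcs walks)

/-- The input of a query: the number of subpaths, and three numbers for each of them. -/
def encode (q : List Subpath) : List ℕ :=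
  q.length :: q.flatMap (fun p => [p.walk, p.first, p.last])

end Subpath

/-! ### The machine model: a real RAM

A random access machine with a memory for natural numbers and one for real numbers, both indexed by
`ℕ`, and read-only input arrays. Every instruction takes one step. The only arithmetic is
addition and subtraction; real numbers can only be moved, added and subtracted. -/

namespace RealRAM

/-- The contents of the memory. -/
structure Memory where
  nat : ℕ → ℕ
  real : ℕ → ℝ

/-- The instructions; cells are denoted by `N[a]` (natural numbers) and `R[a]` (real numbers). -/
inductive Instr where
  /-- `N[a] := c` -/
  | const (a c : ℕ)
  /-- `N[a] := N[b] + N[c]` -/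
  | add (a b c : ℕ)
  /-- `N[a] := N[b] - N[c]`, truncated at `0` -/
  | sub (a b c : ℕ)
  /-- `N[a] := N[N[b]]` -/
  | load (a b : ℕ)
  /-- `N[N[a]] := N[b]` -/
  | store (a b : ℕ)
  /-- `N[a] :=` entry `N[b]` of the input array of natural numbers -/
  | read (a b : ℕ)
  /-- `R[a] := 0` -/
  | rzero (a : ℕ)
  /-- `R[a] := R[b] + R[c]` -/
  | radd (a b c : ℕ)
  /-- `R[a] := R[b] - R[c]` -/
  | rsub (a b c : ℕ)
  /-- `R[a] := R[N[b]]` -/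
  | rload (a b : ℕ)
  /-- `R[N[a]] := R[b]` -/
  | rstore (a b : ℕ)
  /-- `R[a] :=` entry `N[b]` of the input array of real numbers -/
  | rread (a b : ℕ)
  /-- go to instruction `l` if `N[a] ≤ N[b]` -/
  | jle (a b l : ℕ)

/-- A program halts when it jumps or runs beyond its last instruction. -/
abbrev Program := List Instr

/-- A configuration: the index of the next instruction, and the memory. -/
structure Config where
  pc : ℕ
  mem : Memory

namespace Memory

/-- All cells hold `0`. -/
noncomputable def zero : Memory := ⟨fun _ => 0, fun _ => 0⟩

/-- Write to a natural number cell. -/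
def setNat (M : Memory) (a x : ℕ) : Memory := ⟨Function.update M.nat a x, M.real⟩

/-- Write to a real number cell. -/
def setReal (M : Memory) (a : ℕ) (x : ℝ) : Memory := ⟨M.nat, Function.update M.real a x⟩

end Memory

/-- The effect of an instruction. -/
noncomputable def exec (inN : List ℕ) (inR : List ℝ) (c : Config) : Instr → Config
  | .const a k => ⟨c.pc + 1, c.mem.setNat a k⟩
  | .add a b d => ⟨c.pc + 1, c.mem.setNat a (c.mem.nat b + c.mem.nat d)⟩
  | .sub a b d => ⟨c.pc + 1, c.mem.setNat a (c.mem.nat b - c.mem.nat d)⟩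
  | .load a b => ⟨c.pc + 1, c.mem.setNat a (c.mem.nat (c.mem.nat b))⟩
  | .store a b => ⟨c.pc + 1, c.mem.setNat (c.mem.nat a) (c.mem.nat b)⟩
  | .read a b => ⟨c.pc + 1, c.mem.setNat a (inN.getD (c.mem.nat b) 0)⟩
  | .rzero a => ⟨c.pc + 1, c.mem.setReal a 0⟩
  | .radd a b d => ⟨c.pc + 1, c.mem.setReal a (c.mem.real b + c.mem.real d)⟩
  | .rsub a b d => ⟨c.pc + 1, c.mem.setReal a (c.mem.real b - c.mem.real d)⟩
  | .rload a b => ⟨c.pc + 1, c.mem.setReal a (c.mem.real (c.mem.nat b))⟩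
  | .rstore a b => ⟨c.pc + 1, c.mem.setReal (c.mem.nat a) (c.mem.real b)⟩
  | .rread a b => ⟨c.pc + 1, c.mem.setReal a (inR.getD (c.mem.nat b) 0)⟩
  | .jle a b l => ⟨if c.mem.nat a ≤ c.mem.nat b then l else c.pc + 1, c.mem⟩

/-- One step; a halted configuration does not change. -/
noncomputable def step (P : Program) (inN : List ℕ) (inR : List ℝ) (c : Config) : Config :=
  match P[c.pc]? with
  | some i => exec inN inR c i
  | none => c

/-- Started at its first instruction with memory `M` and the given input, the program `P` halts
within `t` steps, and then the memory is `M'`. -/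
def HaltsWithin (P : Program) (inN : List ℕ) (inR : List ℝ) (M : Memory) (t : ℕ) (M' : Memory) :
    Prop :=
  ∃ pc, P.length ≤ pc ∧ (step P inN inR)^[t] ⟨0, M⟩ = ⟨pc, M'⟩

end RealRAM

namespace PlaneGraph

open Finset

variable {n D : ℕ} (G : PlaneGraph n D)

/-! ### Exactness: closed dual chains are coboundaries -/

/-! Send the weight of every vertex to `x₀` along a spanning tree, and let `φ d` be the net weight
carried from the head of the dart `d` to its tail. Across a clockwise simple curve around `x₀`, the
net weight carried inwards is exactly the weight of the exterior, and it is the sum of `φ` over the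
arcs of the curve. Subtracting it from the total weight gives the interior. The sum of `φ` over a
subpath is a difference of two stored prefix sums, so each subpath costs constant time.

The flow argument is made precise by a potential. A closed dual walk is a cycle on the sphere, hence
the signed crossing numbers are the differences of a function `w` on the vertices
(`exists_isPotential`). This is the exactness statement `exists_potential`, a dimension count:
coboundaries and face boundaries are orthogonal, and Euler's formula says that together they fill
the antisymmetric functions. Summation by parts (`IsFlow`) turns the sum of `φ` over the walk into
`∑ v, ω v * (w v - w x₀)`.

It remains to see that `w` takes only two values, which plays the role of the Jordan curve theorem
(`potential_sub_eq_indicator`). The value immediately to the right of the curve does not change from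
one crossing to the next, because the pieces of the curve within a face are not interlaced
(`rightValue_finRotate`).

The programs are written in a small structured language with a compiler to the machine. The
predicate `Wp` tracks running time and final state together; `wp_preprocessCmd` and `wp_queryCmd`
are the resulting specifications. For simple graphs, `IsSimple.card_darts_le` bounds the darts by
the vertices. -/

lemma rev_injective : Function.Injective G.rev :=
  Function.LeftInverse.injective G.rev_rev

/-- The reversal as a permutation. -/
def revPerm : Equiv.Perm (Fin D) := Function.Involutive.toPerm G.rev G.rev_rev

lemma sum_comp_rev {M : Type*} [AddCommMonoid M] (f : Fin D → M) :
    ∑ d, f (G.rev d) = ∑ d, f d :=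
  Equiv.sum_comp G.revPerm f

lemma tail_rot (d : Fin D) : G.tail (G.rot d) = G.tail d :=
  ((G.sameCycle_rot_iff _ _).1 (Equiv.Perm.sameCycle_apply_left.2 (Equiv.Perm.SameCycle.refl _ _)))

lemma rot_facePerm (d : Fin D) : G.rot (G.facePerm d) = G.rev d :=
  G.rot.apply_symm_apply (G.rev d)

lemma tail_facePerm (d : Fin D) : G.tail (G.facePerm d) = G.tail (G.rev d) := by
  rw [← G.rot_facePerm, tail_rot]

/-- The faces of the graph. -/
abbrev Face : Type := Quotient (Equiv.Perm.SameCycle.setoid G.facePerm)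

noncomputable instance : Fintype G.Face := Fintype.ofFinite _

/-- The face to the left of a dart. -/
def face (d : Fin D) : G.Face := Quotient.mk _ d

lemma face_eq_iff {d e : Fin D} : G.face d = G.face e ↔ G.SameFace d e :=
  Quotient.eq (r := Equiv.Perm.SameCycle.setoid G.facePerm)

lemma face_facePerm (d : Fin D) : G.face (G.facePerm d) = G.face d :=
  G.face_eq_iff.2 (Equiv.Perm.sameCycle_apply_left.2 (Equiv.Perm.SameCycle.refl _ _))

/-- A function on the darts that is invariant under the rotation factors through the tails. -/
lemma eq_of_tail_eq {α : Type*} {f : Fin D → α} (hf : ∀ d, f (G.rot d) = f d) {d e : Fin D}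
    (h : G.tail d = G.tail e) : f d = f e := by
  obtain ⟨k, hk⟩ := ((G.sameCycle_rot_iff d e).2 h).exists_nat_pow_eq
  rw [← hk]
  clear hk
  induction k with
  | zero => rfl
  | succ k ih => rw [pow_succ', Equiv.Perm.mul_apply, hf, ← ih]

/-- A function on the darts that is invariant under rotation and reversal is constant. -/
lemma eq_of_invariant {α : Type*} {f : Fin D → α} (h₁ : ∀ d, f (G.rot d) = f d)
    (h₂ : ∀ d, f (G.rev d) = f d) (d e : Fin D) : f d = f e := by
  have key : ∀ v, Relation.ReflTransGen (fun a b => ∃ d, G.tail d = a ∧ G.tail (G.rev d) = b)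
      (G.tail d) v → ∀ e, G.tail e = v → f d = f e := by
    intro v hv
    induction hv with
    | refl => exact fun e he => G.eq_of_tail_eq h₁ he.symm
    | tail _ hbc ih =>
      obtain ⟨d', hd', rfl⟩ := hbc
      intro e he
      rw [ih d' hd', ← h₂ d']
      exact G.eq_of_tail_eq h₁ he.symm
  exact key _ (G.connected _ _) e rfl

lemma exists_tail_eq (hD : 0 < D) (v : Fin n) : ∃ d, G.tail d = v := by
  have h := G.connected v (G.tail ⟨0, hD⟩)
  rcases Relation.ReflTransGen.cases_head h with h | ⟨_, ⟨d, hd, _⟩, _⟩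
  · exact ⟨_, h.symm⟩
  · exact ⟨d, hd⟩

/-- The coboundary of a function on the vertices plus the boundary of a function on the faces. -/
noncomputable def hodge : ((Fin n → ℝ) × (G.Face → ℝ)) →ₗ[ℝ] (Fin D → ℝ) where
  toFun p d := (p.1 (G.tail (G.rev d)) - p.1 (G.tail d)) +
    (p.2 (G.face d) - p.2 (G.face (G.rev d)))
  map_add' p q := by ext d; simp; ring
  map_smul' a p := by ext d; simp; ring

lemma hodge_apply (w : Fin n → ℝ) (y : G.Face → ℝ) (d : Fin D) :
    G.hodge (w, y) d = (w (G.tail (G.rev d)) - w (G.tail d)) +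
      (y (G.face d) - y (G.face (G.rev d))) := rfl

/-- The antisymmetric functions on the darts. -/
def antisymm : Submodule ℝ (Fin D → ℝ) where
  carrier := {c | ∀ d, c (G.rev d) = - c d}
  add_mem' ha hb d := by simp [ha d, hb d]; ring
  zero_mem' d := by simp
  smul_mem' a c hc d := by simp [hc d]

/-- Substituting `G.rev d` for `d` shows that the part with `y (G.rev d)` is minus the part with `y
d`. -/
lemma sum_antisymm_mul {c : Fin D → ℝ} (hc : ∀ d, c (G.rev d) = - c d) (y : Fin D → ℝ) :
    ∑ d, c d * (y d - y (G.rev d)) = 2 * ∑ d, c d * y d := by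
  have h := G.sum_comp_rev (fun d => c d * y (G.rev d))
  simp only [hc, G.rev_rev] at h
  simp only [mul_sub, sum_sub_distrib, ← h, neg_mul, sum_neg_distrib]
  ring

/-- Coboundaries and boundaries are orthogonal. -/
lemma sum_coboundary_mul_boundary (w : Fin n → ℝ) (y : G.Face → ℝ) :
    ∑ d, (w (G.tail (G.rev d)) - w (G.tail d)) * (y (G.face d) - y (G.face (G.rev d))) = 0 := by
  rw [G.sum_antisymm_mul (fun d => by rw [G.rev_rev]; ring) (fun d => y (G.face d))]
  -- Along a face, the next tail is the present head, so a coboundary sums to zero over each face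
  -- boundary.
  have h := Equiv.sum_comp G.facePerm (fun d => w (G.tail d) * y (G.face d))
  simp only [tail_facePerm, face_facePerm] at h
  simp only [sub_mul, sum_sub_distrib, h, sub_self, mul_zero]

lemma eq_zero_of_sum_mul_self {f : Fin D → ℝ} (h : ∑ d, f d * f d = 0) (d : Fin D) : f d = 0 := by
  have := (sum_eq_zero_iff_of_nonneg (fun d _ => mul_self_nonneg (f d))).1 h d (mem_univ d)
  exact mul_self_eq_zero.1 this

/-- Two orthogonal vectors with sum zero are orthogonal to themselves. -/
lemma coboundary_eq_zero_of_hodge_eq_zero {w : Fin n → ℝ} {y : G.Face → ℝ}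
    (h : G.hodge (w, y) = 0) (d : Fin D) :
    w (G.tail (G.rev d)) - w (G.tail d) = 0 ∧ y (G.face d) - y (G.face (G.rev d)) = 0 := by
  have h1 : ∀ d, (w (G.tail (G.rev d)) - w (G.tail d)) = -(y (G.face d) - y (G.face (G.rev d))) :=
    fun d => eq_neg_of_add_eq_zero_left (congrFun h d)
  have h2 := G.sum_coboundary_mul_boundary w y
  simp only [h1, neg_mul, sum_neg_distrib, neg_eq_zero] at h2
  have h3 := eq_zero_of_sum_mul_self h2 d
  exact ⟨by rw [h1, h3, neg_zero], h3⟩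

/-- Both components of a kernel element are constant, by connectedness, so the values at one vertex
and one face determine it. -/
lemma finrank_ker_hodge_le (hD : 0 < D) : Module.finrank ℝ (LinearMap.ker G.hodge) ≤ 2 := by
  let d₀ : Fin D := ⟨0, hD⟩
  let ev : ((Fin n → ℝ) × (G.Face → ℝ)) →ₗ[ℝ] (ℝ × ℝ) :=
    { toFun := fun p => (p.1 (G.tail d₀), p.2 (G.face d₀))
      map_add' := fun _ _ => rfl
      map_smul' := fun _ _ => rfl }
  have hinj : Function.Injective (ev.comp (LinearMap.ker G.hodge).subtype) := by
    rw [← LinearMap.ker_eq_bot, LinearMap.ker_eq_bot']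
    rintro ⟨⟨w, y⟩, hp⟩ h0
    have hw0 : w (G.tail d₀) = 0 := congrArg Prod.fst h0
    have hy0 : y (G.face d₀) = 0 := congrArg Prod.snd h0
    have hk := G.coboundary_eq_zero_of_hodge_eq_zero (LinearMap.mem_ker.1 hp)
    have hw : w = 0 := by
      ext v
      obtain ⟨d, rfl⟩ := G.exists_tail_eq hD v
      rw [Pi.zero_apply, ← hw0]
      exact G.eq_of_invariant (f := fun d => w (G.tail d)) (fun d => by simp only [tail_rot])
        (fun d => sub_eq_zero.1 (hk d).1) d d₀
    have hy : y = 0 := by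
      ext f
      obtain ⟨d, rfl⟩ := Quotient.exists_rep f
      rw [Pi.zero_apply, ← hy0]
      refine G.eq_of_invariant (f := fun d => y (G.face d)) (fun d => ?_)
        (fun d => (sub_eq_zero.1 (hk d).2).symm) d d₀
      -- The face right of `G.rot d` is the face left of `d`. Hence invariance of `y` under reversal
      -- yields invariance under rotation, and connectedness of `G` itself suffices for the faces.
      have h1 : G.facePerm (G.rev (G.rot d)) = d := by
        apply G.rot.injective
        rw [rot_facePerm, G.rev_rev]
      have h2 := (hk (G.rot d)).2
      rw [← G.face_facePerm (G.rev (G.rot d)), h1] at h2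
      exact sub_eq_zero.1 h2
    simp [hw, hy]
  have := LinearMap.finrank_le_finrank_of_injective hinj
  simpa using this

lemma two_mul_card_lt_rev : 2 * #{d : Fin D | d < G.rev d} = D := by
  have h1 : #{d : Fin D | d < G.rev d} = #{d : Fin D | ¬ d < G.rev d} := by
    refine card_bij (fun d _ => G.rev d) ?_ (fun a _ b _ h => G.rev_injective h) ?_
    · intro d hd
      simp only [mem_filter, mem_univ, true_and, G.rev_rev] at hd ⊢
      exact hd.le.not_gt
    · intro d hd
      simp only [mem_filter, mem_univ, true_and] at hd
      refine ⟨G.rev d, ?_, G.rev_rev d⟩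
      simp only [mem_filter, mem_univ, true_and, G.rev_rev]
      exact lt_of_le_of_ne (not_lt.1 hd) (G.rev_ne d)
  have h2 := card_filter_add_card_filter_not (s := (univ : Finset (Fin D)))
    (fun d => d < G.rev d)
  rw [card_univ, Fintype.card_fin] at h2
  omega

/-- An antisymmetric function is determined by its values on the smaller dart of each edge. -/
lemma two_mul_finrank_antisymm_le : 2 * Module.finrank ℝ G.antisymm ≤ D := by
  let P : Type := {d : Fin D // d < G.rev d}
  let res : (Fin D → ℝ) →ₗ[ℝ] (P → ℝ) := LinearMap.funLeft ℝ ℝ (fun p : P => p.1)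
  have hinj : Function.Injective (res.comp G.antisymm.subtype) := by
    rw [← LinearMap.ker_eq_bot, LinearMap.ker_eq_bot']
    rintro ⟨c, hc⟩ h0
    have hc0 : ∀ d, d < G.rev d → c d = 0 := fun d hd => congrFun h0 ⟨d, hd⟩
    have : c = 0 := by
      ext d
      rcases lt_or_gt_of_ne (G.rev_ne d) with h | h
      · have h1 := hc0 (G.rev d) (by rwa [G.rev_rev])
        rw [hc d, neg_eq_zero] at h1
        exact h1
      · exact hc0 d h
    simp [this]
  have h1 := LinearMap.finrank_le_finrank_of_injective hinj
  rw [Module.finrank_fintype_fun_eq_card, Fintype.card_subtype] at h1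
  have h2 := G.two_mul_card_lt_rev
  omega

/-- Rank-nullity gives rank at least `n + F - 2`, with `F` the number of faces. By Euler's formula
this is `D / 2`, the upper bound for the dimension of the antisymmetric functions. -/
lemma range_hodge (hD : 0 < D) : LinearMap.range G.hodge = G.antisymm := by
  apply Submodule.eq_of_le_of_finrank_le
  · rintro _ ⟨⟨w, y⟩, rfl⟩ d
    simp only [hodge_apply, G.rev_rev]
    ring
  · have h1 := LinearMap.finrank_range_add_finrank_ker G.hodge
    have h2 := G.finrank_ker_hodge_le hD
    have h3 := G.two_mul_finrank_antisymm_le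
    have h4 : 2 * n + 2 * Nat.card G.Face = D + 4 := G.euler hD
    rw [Module.finrank_prod, Module.finrank_fintype_fun_eq_card,
      Module.finrank_fintype_fun_eq_card, Fintype.card_fin, ← Nat.card_eq_fintype_card] at h1
    omega

/-- On the sphere, an antisymmetric function on the darts whose sum over the boundary of every face
vanishes is a coboundary. -/
theorem exists_potential (hD : 0 < D) {c : Fin D → ℝ} (hc : ∀ d, c (G.rev d) = - c d)
    (hsum : ∀ y : G.Face → ℝ, ∑ d, c d * y (G.face d) = 0) :
    ∃ w : Fin n → ℝ, ∀ d, w (G.tail (G.rev d)) - w (G.tail d) = c d := by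
  have hmem : c ∈ LinearMap.range G.hodge := by rw [G.range_hodge hD]; exact hc
  obtain ⟨⟨w, y⟩, rfl⟩ := hmem
  refine ⟨w, fun d => ?_⟩
  -- Both `c` and its coboundary part are orthogonal to the boundary part, so the latter has norm
  -- zero.
  have h1 := G.sum_antisymm_mul hc (fun d => y (G.face d))
  rw [hsum, mul_zero] at h1
  simp only [hodge_apply, add_mul, sum_add_distrib, G.sum_coboundary_mul_boundary w y,
    zero_add] at h1
  rw [hodge_apply, eq_zero_of_sum_mul_self h1 d, add_zero]

end PlaneGraph

namespace PlaneGraph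

open Finset

variable {n D : ℕ} (G : PlaneGraph n D)

/-! ### Simple perturbations separate the sphere into two sides -/

lemma finRotate_succ_reindex {M : Type*} [AddCommMonoid M] {m : ℕ} (f : Fin m → M) :
    ∑ i, f (finRotate m i) = ∑ i, f i :=
  Equiv.sum_comp (finRotate m) f

/-- The sign of the `j`-th crossing on `d`: `1` if it goes from the right side to the left side of
the curve, `-1` if it goes from left to right, `0` if it is no crossing of `d`. -/
noncomputable def crossSign (γ : List (Fin D)) (d : Fin D) (j : Fin γ.length) : ℝ :=
  (if γ.get j = d then 1 else 0) - (if G.rev (γ.get j) = d then 1 else 0)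

lemma crossSign_rev (γ : List (Fin D)) (d : Fin D) (j : Fin γ.length) :
    G.crossSign γ (G.rev d) j = - G.crossSign γ d j := by
  have h : γ.get j = G.rev d ↔ G.rev (γ.get j) = d :=
    ⟨fun h => by rw [h, G.rev_rev], fun h => by rw [← h, G.rev_rev]⟩
  simp only [crossSign, h, G.rev_injective.eq_iff]
  ring

lemma crossSign_get (γ : List (Fin D)) (j : Fin γ.length) : G.crossSign γ (γ.get j) j = 1 := by
  simp [crossSign, G.rev_ne]

lemma crosses_iff {γ : List (Fin D)} {d : Fin D} {i : Fin γ.length} :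
    G.Crosses γ d i ↔ γ.get i = d ∨ G.rev (γ.get i) = d := by
  rw [Crosses]
  refine or_congr Iff.rfl ⟨fun h => by rw [h, G.rev_rev], fun h => by rw [← h, G.rev_rev]⟩

lemma crossSign_of_not_crosses {γ : List (Fin D)} {d : Fin D} {j : Fin γ.length}
    (h : ¬ G.Crosses γ d j) : G.crossSign γ d j = 0 := by
  rw [crosses_iff, not_or] at h
  rw [crossSign, if_neg h.1, if_neg h.2, sub_zero]

lemma crosses_rev {γ : List (Fin D)} {d : Fin D} {i : Fin γ.length} :
    G.Crosses γ (G.rev d) i ↔ G.Crosses γ d i := by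
  rw [Crosses, Crosses, G.rev_rev, or_comm]

lemma crosses_get (γ : List (Fin D)) (i : Fin γ.length) : G.Crosses γ (γ.get i) i := Or.inl rfl

lemma coord_rev {γ : List (Fin D)} {pos : Fin γ.length → ℤ} {d : Fin D} {i : Fin γ.length}
    (h : G.Crosses γ d i) : coord γ pos (G.rev d) i = - coord γ pos d i := by
  rcases h with h | h
  · rw [coord, coord, if_pos h, if_neg (by rw [h]; exact (G.rev_ne d).symm)]
  · rw [coord, coord, if_pos h, if_neg (by rw [h]; exact G.rev_ne d), neg_neg]

/-- A potential of a closed dual walk: it increases by one whenever the walk is crossed from right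
to left. -/
def IsPotential (γ : List (Fin D)) (w : Fin n → ℝ) : Prop :=
  ∀ d, w (G.tail (G.rev d)) - w (G.tail d) = ∑ j, G.crossSign γ d j

lemma exists_isPotential {γ : List (Fin D)} (hγ : G.IsClosedDualWalk γ) :
    ∃ w, G.IsPotential γ w := by
  obtain ⟨hne, hγ⟩ := hγ
  have hD : 0 < D := by
    rcases γ with _ | ⟨a, _⟩
    · exact absurd rfl hne
    · exact a.pos
  refine G.exists_potential hD (fun d => ?_) (fun y => ?_)
  · simp only [crossSign_rev, sum_neg_distrib]
  · simp only [sum_mul]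
    rw [sum_comm]
    -- Each arc contributes `y` at the face it leaves minus `y` at the face it enters; around the
    -- closed walk this telescopes.
    have h1 : ∀ j : Fin γ.length, ∑ d, G.crossSign γ d j * y (G.face d) =
        y (G.face (γ.get j)) - y (G.face (γ.get (finRotate _ j))) := by
      intro j
      rw [← G.face_eq_iff.2 (hγ j)]
      simp [crossSign, sub_mul, sum_sub_distrib]
    rw [sum_congr rfl (fun j _ => h1 j), sum_sub_distrib,
      finRotate_succ_reindex (fun j => y (G.face (γ.get j))), sub_self]

/-- The value of the potential on `d` just before position `x`. -/
noncomputable def before (γ : List (Fin D)) (pos : Fin γ.length → ℤ) (w : Fin n → ℝ) (d : Fin D)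
    (x : ℤ) : ℝ :=
  w (G.tail d) + ∑ j, if coord γ pos d j < x then G.crossSign γ d j else 0

section Separation

variable {G}
variable {γ : List (Fin D)} {pos : Fin γ.length → ℤ} {w : Fin n → ℝ}

lemma before_eq_of_isFirstCrossing {d : Fin D} {i : Fin γ.length}
    (h : G.IsFirstCrossing γ pos d i) : G.before γ pos w d (coord γ pos d i) = w (G.tail d) := by
  rw [before, add_eq_left]
  refine sum_eq_zero fun j _ => ?_
  by_cases hj : G.Crosses γ d j
  · rw [if_neg (not_lt.2 (h.2 j hj))]
  · rw [G.crossSign_of_not_crosses hj, ite_self]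

/-- Seen from the head of `d`, the crossings before `i` are those that lie after it on `d`. The
difference of `w` between the ends of `d` splits into the crossings before `i`, the crossing `i`,
and those after it; distinctness of positions excludes any other crossing at the place of `i`. -/
lemma before_rev (hw : G.IsPotential γ w) (hpos : G.IsSimplePerturbation γ pos) {d : Fin D}
    {i : Fin γ.length} (h : G.Crosses γ d i) :
    G.before γ pos w (G.rev d) (coord γ pos (G.rev d) i) =
      G.before γ pos w d (coord γ pos d i) + G.crossSign γ d i := by
  have h1 := hw d
  have h2 : ∀ j, (if coord γ pos (G.rev d) j < coord γ pos (G.rev d) i then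
      G.crossSign γ (G.rev d) j else 0) =
      ((if coord γ pos d j < coord γ pos d i then G.crossSign γ d j else 0) +
        if j = i then G.crossSign γ d i else 0) - G.crossSign γ d j := by
    intro j
    by_cases hj : G.Crosses γ d j
    · rw [G.coord_rev h, G.coord_rev hj, crossSign_rev]
      by_cases hji : j = i
      · subst hji
        simp
      · have h3 := hpos.1 d j i hj h hji
        rcases lt_or_gt_of_ne h3 with h4 | h4
        · simp [h4, hji, not_lt.2 h4.le]
        · simp [h4, hji, not_lt.2 h4.le]
    · have hji : j ≠ i := fun e => hj (e ▸ h)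
      have hj' := fun h => hj (G.crosses_rev.1 h)
      simp [G.crossSign_of_not_crosses hj, G.crossSign_of_not_crosses hj', hji]
  rw [before, before, sum_congr rfl (fun j _ => h2 j), sum_sub_distrib, sum_add_distrib]
  simp only [sum_ite_eq', mem_univ, if_true]
  linarith

lemma iterate_facePerm_rank {r d : Fin D} (h : G.SameFace r d) :
    (⇑G.facePerm)^[G.rank r d] r = d := by
  have hne : {k : ℕ | (⇑G.facePerm)^[k] r = d}.Nonempty := by
    obtain ⟨k, hk⟩ := h.exists_nat_pow_eq
    exact ⟨k, by rw [← hk, Set.mem_ofPred_eq, Equiv.Perm.iterate_eq_pow]⟩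
  exact Nat.sInf_mem hne

lemma rank_injective {r d e : Fin D} (hd : G.SameFace r d) (he : G.SameFace r e)
    (h : G.rank r d = G.rank r e) : d = e := by
  rw [← iterate_facePerm_rank hd, ← iterate_facePerm_rank he, h]

lemma rank_le {r d : Fin D} {k : ℕ} (h : (⇑G.facePerm)^[k] r = d) : G.rank r d ≤ k :=
  Nat.sInf_le h

lemma sameFace_iterate (r : Fin D) (k : ℕ) : G.SameFace r ((⇑G.facePerm)^[k] r) :=
  ⟨k, by rw [Equiv.Perm.iterate_eq_pow]; rfl⟩

/-- Before the dart `d` is reached, the boundary of the face is traversed without repetition. -/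
lemma rank_iterate {r d : Fin D} (hd : G.SameFace r d) {k : ℕ} (hk : k ≤ G.rank r d) :
    G.rank r ((⇑G.facePerm)^[k] r) = k := by
  refine le_antisymm (rank_le rfl) (not_lt.1 fun hlt => ?_)
  have h1 := iterate_facePerm_rank (sameFace_iterate (G := G) r k)
  set l := G.rank r ((⇑G.facePerm)^[k] r)
  have h2 : (⇑G.facePerm)^[G.rank r d - k + l] r = d := by
    rw [Function.iterate_add_apply, h1, ← Function.iterate_add_apply, Nat.sub_add_cancel hk,
      iterate_facePerm_rank hd]
  have := rank_le h2
  omega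

open Classical in
-- Telescoping of `w` along the first `k` darts of the face boundary. Up to `d` there is no
-- repetition (`rank_iterate`), so raising `k` by one adds the crossings of exactly one dart.
lemma sum_rank_lt (hw : G.IsPotential γ w) {r d : Fin D} (hd : G.SameFace r d) {k : ℕ}
    (hk : k ≤ G.rank r d) :
    ∑ j : Fin γ.length, ((if G.SameFace r (γ.get j) ∧ G.rank r (γ.get j) < k then (1 : ℝ) else 0) -
      (if G.SameFace r (G.rev (γ.get j)) ∧ G.rank r (G.rev (γ.get j)) < k then 1 else 0)) =
      w (G.tail ((⇑G.facePerm)^[k] r)) - w (G.tail r) := by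
  induction k with
  | zero => simp
  | succ k ih =>
    have h1 := rank_iterate hd (Nat.le_of_succ_le hk)
    have h2 : ∀ e, (if G.SameFace r e ∧ G.rank r e < k + 1 then (1 : ℝ) else 0) =
        (if G.SameFace r e ∧ G.rank r e < k then 1 else 0) +
          (if e = (⇑G.facePerm)^[k] r then 1 else 0) := by
      intro e
      by_cases he : e = (⇑G.facePerm)^[k] r
      · have h3 := sameFace_iterate (G := G) r k
        rw [← he] at h3 h1
        simp [← he, h1, h3]
      · by_cases h3 : G.SameFace r e
        · have h4 : G.rank r e ≠ k := fun h4 =>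
            he (rank_injective h3 (sameFace_iterate r k) (h4.trans h1.symm))
          have h5 : G.rank r e < k + 1 ↔ G.rank r e < k := by omega
          simp [he, h5]
        · simp [h3, he]
    have h3 := hw ((⇑G.facePerm)^[k] r)
    rw [Function.iterate_succ_apply', tail_facePerm]
    simp only [h2]
    simp only [crossSign, sum_sub_distrib, sum_add_distrib] at h3 ih ⊢
    linarith [ih (Nat.le_of_succ_le hk)]

open Classical in
/-- The potential at a point of the boundary of a face, in terms of the ends of the pieces of the
curve in that face. -/
lemma before_eq_sum_place (hw : G.IsPotential γ w) {r d : Fin D} (hd : G.SameFace r d)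
    (i : Fin γ.length) :
    G.before γ pos w d (coord γ pos d i) = w (G.tail r) +
      ∑ j : Fin γ.length,
        ((if G.SameFace r (γ.get j) ∧ G.place γ pos r (γ.get j) j < G.place γ pos r d i
          then (1 : ℝ) else 0) -
        (if G.SameFace r (G.rev (γ.get j)) ∧
          G.place γ pos r (G.rev (γ.get j)) j < G.place γ pos r d i then 1 else 0)) := by
  have h1 := sum_rank_lt hw hd le_rfl
  rw [iterate_facePerm_rank hd] at h1
  have h2 : ∀ e j, (if G.SameFace r e ∧ G.place γ pos r e j < G.place γ pos r d i
          then (1 : ℝ) else 0) =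
        (if G.SameFace r e ∧ G.rank r e < G.rank r d then 1 else 0) +
          (if coord γ pos d j < coord γ pos d i then if e = d then 1 else 0 else 0) := by
    intro e j
    have hlex : G.place γ pos r e j < G.place γ pos r d i ↔ G.rank r e < G.rank r d ∨
        (G.rank r e = G.rank r d ∧ coord γ pos e j < coord γ pos d i) := Prod.Lex.toLex_lt_toLex
    simp only [hlex]
    by_cases hed : e = d
    · subst hed
      simp [hd]
    · by_cases h3 : G.SameFace r e
      · have h4 : G.rank r e ≠ G.rank r d := fun h4 => hed (rank_injective h3 hd h4)
        simp [h4, hed]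
      · simp [h3, hed]
  simp only [h2]
  have h3 : ∀ j, (if coord γ pos d j < coord γ pos d i then G.crossSign γ d j else 0) =
      (if coord γ pos d j < coord γ pos d i then if γ.get j = d then 1 else 0 else 0) -
      (if coord γ pos d j < coord γ pos d i then if G.rev (γ.get j) = d then 1 else 0 else 0) := by
    intro j
    split_ifs <;> simp_all [crossSign]
  simp only [before, h3]
  simp only [sum_sub_distrib, sum_add_distrib] at h1 ⊢
  linarith

lemma place_injective (hpos : G.IsSimplePerturbation γ pos) {r d e : Fin D} {i j : Fin γ.length}
    (hd : G.SameFace r d) (he : G.SameFace r e) (hi : G.Crosses γ d i) (hj : G.Crosses γ e j)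
    (h : G.place γ pos r d i = G.place γ pos r e j) : d = e ∧ i = j := by
  have h' : (G.rank r d, coord γ pos d i) = (G.rank r e, coord γ pos e j) := toLex.injective h
  rw [Prod.mk.injEq] at h'
  obtain rfl := rank_injective hd he h'.1
  refine ⟨rfl, by_contra fun hij => hpos.1 d i j hi hj hij h'.2⟩

/-- Moving a threshold from `a` to `a'` passes both or neither of `b`, `b'`, so the difference of
their two indicators is unchanged. This is the only use made of the absence of interlacing. -/
lemma interlace_count {α : Type*} [LinearOrder α] {a a' b b' : α} (h : ¬ Interlaced a a' b b')
    (h₁ : b ≠ a) (h₂ : b ≠ a') (h₃ : b' ≠ a) (h₄ : b' ≠ a') :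
    ((if b' < a' then (1 : ℝ) else 0) - if b < a' then 1 else 0) =
      (if b' < a then 1 else 0) - if b < a then 1 else 0 := by
  rw [Interlaced, xor_iff_not_iff, not_not] at h
  rcases lt_or_ge a a' with ha | ha
  · rw [min_eq_left ha.le, max_eq_right ha.le] at h
    rcases lt_or_gt_of_ne h₁ with h1 | h1 <;> rcases lt_or_gt_of_ne h₂ with h2 | h2 <;>
    rcases lt_or_gt_of_ne h₃ with h3 | h3 <;> rcases lt_or_gt_of_ne h₄ with h4 | h4 <;>
    simp_all [not_lt.2 (le_of_lt _)] <;> grind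
  · rw [min_eq_right ha, max_eq_left ha] at h
    rcases lt_or_gt_of_ne h₁ with h1 | h1 <;> rcases lt_or_gt_of_ne h₂ with h2 | h2 <;>
    rcases lt_or_gt_of_ne h₃ with h3 | h3 <;> rcases lt_or_gt_of_ne h₄ with h4 | h4 <;>
    simp_all [not_lt.2 (le_of_lt _)] <;> grind

/-- The value of the potential on the right side of the curve, at the `i`-th crossing. -/
noncomputable def rightValue (G : PlaneGraph n D) (γ : List (Fin D)) (pos : Fin γ.length → ℤ)
    (w : Fin n → ℝ) (i : Fin γ.length) : ℝ :=
  G.before γ pos w (γ.get i) (coord γ pos (γ.get i) i)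

open Classical in
-- Crossing `i` raises the potential by one. Going along the face boundary from there to the next
-- crossing, every other piece has no net effect by `interlace_count`, and the piece from `i` itself
-- lowers the potential by one. So the next crossing begins at the same value.
lemma rightValue_finRotate (hγ : G.IsClosedDualWalk γ) (hw : G.IsPotential γ w)
    (hpos : G.IsSimplePerturbation γ pos) (i : Fin γ.length) :
    rightValue G γ pos w (finRotate _ i) = rightValue G γ pos w i := by
  set r := G.rev (γ.get i)
  have hS : G.SameFace r r := Equiv.Perm.SameCycle.refl _ _
  have hE : ∀ j, G.SameFace r (γ.get (finRotate _ j)) ↔ G.SameFace r (G.rev (γ.get j)) :=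
    fun j => ⟨fun h => h.trans (hγ.2 j).symm, fun h => h.trans (hγ.2 j)⟩
  have hEi : G.SameFace r (γ.get (finRotate _ i)) := (hE i).2 hS
  have h1 := before_rev hw hpos (G.crosses_get γ i)
  rw [crossSign_get] at h1
  -- Shifting the index of the entering crossings groups the sum by pieces: the end of piece `j` is
  -- paired with its start.
  have hR : ∀ p : ℕ ×ₗ ℤ, ∑ j : Fin γ.length,
      ((if G.SameFace r (γ.get j) ∧ G.place γ pos r (γ.get j) j < p then (1 : ℝ) else 0) -
        (if G.SameFace r (G.rev (γ.get j)) ∧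
          G.place γ pos r (G.rev (γ.get j)) j < p then 1 else 0)) =
      ∑ j : Fin γ.length, if G.SameFace r (G.rev (γ.get j)) then
        ((if G.place γ pos r (γ.get (finRotate _ j)) (finRotate _ j) < p then (1 : ℝ) else 0) -
          if G.place γ pos r (G.rev (γ.get j)) j < p then 1 else 0) else 0 := by
    intro p
    rw [sum_sub_distrib, ← finRotate_succ_reindex, ← sum_sub_distrib]
    refine sum_congr rfl fun j _ => ?_
    rw [hE j]
    by_cases h : G.SameFace r (G.rev (γ.get j)) <;> simp only [h, true_and, false_and, if_true,
      if_false, sub_zero]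
  have h2 := before_eq_sum_place (pos := pos) hw hS i
  have h3 := before_eq_sum_place (pos := pos) hw hEi (finRotate _ i)
  rw [hR] at h2 h3
  have hcr : ∀ j, G.Crosses γ (G.rev (γ.get j)) j := fun j => G.crosses_rev.2 (G.crosses_get γ j)
  have hSE : ∀ j k, G.SameFace r (G.rev (γ.get j)) → G.SameFace r (γ.get k) →
      G.place γ pos r (G.rev (γ.get j)) j ≠ G.place γ pos r (γ.get k) k := by
    intro j k hj hk h
    obtain ⟨h4, rfl⟩ := place_injective hpos hj hk (hcr j) (G.crosses_get γ k) h
    exact G.rev_ne _ h4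
  have hdiff : ∀ j : Fin γ.length, (if G.SameFace r (G.rev (γ.get j)) then
        ((if G.place γ pos r (γ.get (finRotate _ j)) (finRotate _ j) <
            G.place γ pos r (γ.get (finRotate _ i)) (finRotate _ i) then (1 : ℝ) else 0) -
          if G.place γ pos r (G.rev (γ.get j)) j <
            G.place γ pos r (γ.get (finRotate _ i)) (finRotate _ i) then 1 else 0) else 0) =
      (if G.SameFace r (G.rev (γ.get j)) then
        ((if G.place γ pos r (γ.get (finRotate _ j)) (finRotate _ j) <
            G.place γ pos r r i then (1 : ℝ) else 0) -
          if G.place γ pos r (G.rev (γ.get j)) j <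
            G.place γ pos r r i then 1 else 0) else 0) - if j = i then 1 else 0 := by
    intro j
    by_cases hj : G.SameFace r (G.rev (γ.get j))
    · by_cases hji : j = i
      · subst hji
        rcases lt_or_gt_of_ne (hSE j _ hj hEi) with h4 | h4
        · simp only [r, h4, hj, not_lt.2 h4.le, lt_irrefl, if_true, if_false]; norm_num
        · simp only [r, h4, hj, not_lt.2 h4.le, lt_irrefl, if_true, if_false]; norm_num
      · simp only [hj, if_true, hji, if_false, sub_zero]
        refine interlace_count (hpos.2 r i j (Ne.symm hji) hS hj) ?_ (hSE j _ hj hEi)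
          (hSE i _ hS ((hE j).2 hj)).symm ?_
        · exact fun h => hji (place_injective hpos hj hS (hcr j) (hcr i) h).2
        · intro h
          have h4 := (place_injective hpos ((hE j).2 hj) hEi (G.crosses_get γ _)
            (G.crosses_get γ _) h).2
          exact hji ((finRotate _).injective h4)
    · have hji : j ≠ i := fun e => hj (e ▸ hS)
      rw [if_neg hj, if_neg hj, if_neg hji, sub_zero]
  rw [sum_congr rfl (fun j _ => hdiff j), sum_sub_distrib] at h3
  simp only [sum_ite_eq', mem_univ, if_true] at h3
  rw [rightValue, rightValue]
  linarith

lemma rightValue_const (hγ : G.IsClosedDualWalk γ) (hw : G.IsPotential γ w)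
    (hpos : G.IsSimplePerturbation γ pos) (i j : Fin γ.length) :
    rightValue G γ pos w i = rightValue G γ pos w j := by
  have h0 : ∀ k (hk : k < γ.length), rightValue G γ pos w ⟨k, hk⟩ =
      rightValue G γ pos w ⟨0, by omega⟩ := by
    intro k
    induction k with
    | zero => exact fun _ => rfl
    | succ k ih =>
      intro hk
      have h1 := rightValue_finRotate hγ hw hpos ⟨k, by omega⟩
      rw [ih] at h1
      rw [← h1]
      congr 1
      -- `finRotate_of_lt` speaks of `Fin (m + 1)`, so the length is generalised to a variable.
      obtain ⟨m, hm⟩ : ∃ m, γ.length = m + 1 := ⟨γ.length - 1, by omega⟩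
      have : ∀ (l : ℕ) (hl : l = m + 1) (h2 : k + 1 < l) ,
          (⟨k + 1, h2⟩ : Fin l) = finRotate l ⟨k, by omega⟩ := by
        rintro l rfl h2
        rw [finRotate_of_lt (by omega)]
      exact this _ hm hk
  exact (h0 i i.2).trans (h0 j j.2).symm

lemma eq_of_joinedOff (hw : G.IsPotential γ w) {u v : Fin n} (h : G.JoinedOff γ u v) :
    w u = w v := by
  induction h with
  | refl => rfl
  | tail _ hbc ih =>
    obtain ⟨d, rfl, rfl, hd⟩ := hbc
    have h1 := hw d
    rw [sum_eq_zero (fun j _ => G.crossSign_of_not_crosses (hd j)), sub_eq_zero] at h1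
    rw [ih, h1]

lemma eq_of_rightOf (hγ : G.IsClosedDualWalk γ) (hw : G.IsPotential γ w)
    (hpos : G.IsSimplePerturbation γ pos) {z : Fin n} (hz : G.RightOf γ pos z)
    (i : Fin γ.length) : w z = rightValue G γ pos w i := by
  obtain ⟨d, j, h1, h2, rfl⟩ := hz
  rw [eq_of_joinedOff hw h1, rightValue_const hγ hw hpos i j, rightValue,
    before_eq_of_isFirstCrossing h2]

lemma eq_of_leftOf (hγ : G.IsClosedDualWalk γ) (hw : G.IsPotential γ w)
    (hpos : G.IsSimplePerturbation γ pos) {z : Fin n} (hz : G.LeftOf γ pos z)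
    (i : Fin γ.length) : w z = rightValue G γ pos w i + 1 := by
  obtain ⟨d, j, h1, h2, h3⟩ := hz
  -- The crossing is approached along the reversed arc, so `w z` is the value just beyond the
  -- crossing, one more than on its right side.
  have h4 := before_rev hw hpos (G.crosses_get γ j)
  rw [crossSign_get, h3, G.rev_rev, before_eq_of_isFirstCrossing h2] at h4
  rw [eq_of_joinedOff hw h1, rightValue_const hγ hw hpos i j, rightValue, h3, h4]

lemma exists_isFirstCrossing {d : Fin D} (h : ∃ i, G.Crosses γ d i) :
    ∃ i, G.IsFirstCrossing γ pos d i := by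
  classical
  obtain ⟨i₀, h₀⟩ := h
  obtain ⟨i, hi, hmin⟩ := exists_min_image (univ.filter fun i => G.Crosses γ d i)
    (coord γ pos d) ⟨i₀, by simpa using h₀⟩
  exact ⟨i, by simpa using hi, fun j hj => hmin j (by simpa using hj)⟩

/-- On a path from `z` to an end of a crossed edge, either some edge is crossed or that last edge is
reached; the first crossing met decides the side. -/
lemma rightOf_or_leftOf (hne : γ ≠ []) (pos : Fin γ.length → ℤ) (z : Fin n) :
    G.RightOf γ pos z ∨ G.LeftOf γ pos z := by
  have key : ∃ d i, G.JoinedOff γ z (G.tail d) ∧ G.IsFirstCrossing γ pos d i := by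
    let i₀ : Fin γ.length := ⟨0, List.length_pos_iff.2 hne⟩
    induction G.connected z (G.tail (γ.get i₀)) using Relation.ReflTransGen.head_induction_on with
    | refl =>
      obtain ⟨i, hi⟩ := exists_isFirstCrossing (pos := pos) ⟨i₀, G.crosses_get γ i₀⟩
      exact ⟨_, i, Relation.ReflTransGen.refl, hi⟩
    | head hab _ ih =>
      obtain ⟨d, rfl, rfl⟩ := hab
      by_cases hd : ∃ i, G.Crosses γ d i
      · obtain ⟨i, hi⟩ := exists_isFirstCrossing (pos := pos) hd
        exact ⟨d, i, Relation.ReflTransGen.refl, hi⟩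
      · obtain ⟨e, i, h1, h2⟩ := ih
        exact ⟨e, i, Relation.ReflTransGen.head ⟨d, rfl, rfl, not_exists.1 hd⟩ h1, h2⟩
  obtain ⟨d, i, h1, h2⟩ := key
  rcases h2.1 with h3 | h3
  · exact Or.inl ⟨d, i, h1, h2, h3⟩
  · exact Or.inr ⟨d, i, h1, h2, h3⟩

/-- The potential is constant in the interior of a clockwise curve, and larger by one outside. -/
theorem potential_sub_eq_indicator (hγ : G.IsClosedDualWalk γ) (hw : G.IsPotential γ w)
    (hpos : G.IsSimplePerturbation γ pos) (hcw : G.IsClockwise γ pos) {x₀ : Fin n}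
    (hx₀ : x₀ ∈ G.interior γ pos) (z : Fin n) :
    w z - w x₀ = 1 - (G.interior γ pos).indicator 1 z := by
  let i : Fin γ.length := ⟨0, List.length_pos_iff.2 hγ.1⟩
  have hinf := eq_of_leftOf hγ hw hpos hcw i
  have hint : ∀ z, z ∈ G.interior γ pos ↔ G.RightOf γ pos z := by
    refine fun z => ⟨fun h => ?_, fun h => Or.inl ⟨h, hcw⟩⟩
    rcases h with h | h
    · exact h.1
    -- Impossible: infinity would lie on both sides, where the potential has different values.
    · have := eq_of_rightOf hγ hw hpos h.2 i
      linarith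
  have h0 := eq_of_rightOf hγ hw hpos ((hint x₀).1 hx₀) i
  by_cases hz : z ∈ G.interior γ pos
  · rw [Set.indicator_of_mem hz, h0, eq_of_rightOf hγ hw hpos ((hint z).1 hz) i]
    simp
  · rw [Set.indicator_of_notMem hz, h0]
    rcases rightOf_or_leftOf hγ.1 pos z with h | h
    · exact absurd ((hint z).2 h) hz
    · rw [eq_of_leftOf hγ hw hpos h i]
      ring

end Separation

end PlaneGraph

namespace PlaneGraph

open Finset

variable {n D : ℕ} (G : PlaneGraph n D)

/-! ### The number of darts of a simple plane graph is linear in the number of its vertices -/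

lemma eq_of_rot_eq_self {d e : Fin D} (hd : G.rot d = d) (h : G.tail e = G.tail d) : e = d := by
  obtain ⟨k, hk⟩ := (G.sameCycle_rot_iff d e).2 h.symm
  rw [← hk, Equiv.Perm.zpow_apply_eq_self_of_apply_eq_self hd]

lemma facePerm_ne_self (hG : G.IsSimple) (d : Fin D) : G.facePerm d ≠ d := fun h =>
  hG.1 d (by rw [← tail_facePerm, h])

/-- In a simple graph, the two darts of a face of length two are opposite. Then both ends have only
one dart, and the graph is a single edge. -/
lemma le_two_of_facePerm_facePerm (hG : G.IsSimple) {d : Fin D}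
    (h : G.facePerm (G.facePerm d) = d) : n ≤ 2 := by
  have h1 : G.facePerm d = G.rev d :=
    hG.2 _ _ (G.tail_facePerm d) (by rw [G.rev_rev, ← tail_facePerm, h])
  have h2 : G.rot (G.rev d) = G.rev d := by rw [← h1, rot_facePerm, h1]
  have h3 : G.rot d = d := by
    have := G.rot_facePerm (G.facePerm d)
    rwa [h, h1, G.rev_rev] at this
  have key : ∀ v, v = G.tail d ∨ v = G.tail (G.rev d) := by
    intro v
    induction G.connected (G.tail d) v with
    | refl => exact Or.inl rfl
    | tail _ hbc ih =>
      obtain ⟨e, rfl, rfl⟩ := hbc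
      rcases ih with ih | ih
      · exact Or.inr (by rw [G.eq_of_rot_eq_self h3 ih])
      · exact Or.inl (by rw [G.eq_of_rot_eq_self h2 ih, G.rev_rev])
  have h4 : (univ : Finset (Fin n)) ⊆ {G.tail d, G.tail (G.rev d)} := fun v _ => by
    simpa using key v
  simpa using (card_le_card h4).trans card_le_two

theorem IsSimple.card_darts_le (hG : G.IsSimple) : D ≤ 6 * n + 4 := by
  rcases Nat.eq_zero_or_pos D with rfl | hD
  · omega
  by_cases hn : n ≤ 2
  · have hinj : Function.Injective (fun d => (G.tail d, G.tail (G.rev d))) := fun d e h =>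
      hG.2 d e (congrArg Prod.fst h) (congrArg Prod.snd h)
    have h1 := Fintype.card_le_of_injective _ hinj
    rw [Fintype.card_fin, Fintype.card_prod, Fintype.card_fin] at h1
    interval_cases n <;> omega
  · classical
    -- Every face has at least three darts; with Euler's formula this gives `D ≤ 6 * n - 12`.
    have h1 : #(univ : Finset G.Face) * 3 ≤ ∑ f : G.Face, #{d | G.face d = f} := by
      rw [← smul_eq_mul]
      refine card_nsmul_le_sum _ _ _ fun f _ => ?_
      obtain ⟨d, rfl⟩ := Quotient.exists_rep f
      have hsub : {d, G.facePerm d, G.facePerm (G.facePerm d)} ⊆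
          ({e | G.face e = G.face d} : Finset (Fin D)) := by
        intro e he
        simp only [mem_insert, mem_singleton] at he
        rcases he with rfl | rfl | rfl <;> simp [face_facePerm]
      refine le_trans (le_of_eq (card_eq_three.2 ⟨_, _, _, ?_, ?_, ?_, rfl⟩).symm)
        (card_le_card hsub)
      · exact (G.facePerm_ne_self hG d).symm
      · exact fun h => hn (G.le_two_of_facePerm_facePerm hG h.symm)
      · exact (G.facePerm_ne_self hG _).symm
    rw [← card_eq_sum_card_fiberwise (fun _ _ => mem_univ _), card_univ, card_univ,
      Fintype.card_fin, ← Nat.card_eq_fintype_card] at h1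
    have h4 : 2 * n + 2 * Nat.card G.Face = D + 4 := G.euler hD
    omega

end PlaneGraph

namespace RealRAM

/-! ### Structured programs for the real RAM

A structured program works on registers and on six unbounded arrays of natural numbers, and likewise
for real numbers. Register `j` is the cell `8 * j`, entry `i` of array `k` is the cell
`8 * i + k + 1`. The cells `7` and `15` hold intermediate results of address computations. -/

/-- The registers and the arrays. -/
@[ext] structure State where
  v : ℕ → ℕ
  a : Fin 6 → ℕ → ℕ
  r : ℕ → ℝ
  ra : Fin 6 → ℕ → ℝ

/-- The registers and the arrays that are stored in a memory. -/
def Memory.view (M : Memory) : State :=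
  ⟨fun j => M.nat (8 * j), fun k i => M.nat (8 * i + k + 1),
    fun j => M.real (8 * j), fun k i => M.real (8 * i + k + 1)⟩

/-- The elementary operations on registers and arrays. -/
inductive Op where
  /-- `v x := c` -/
  | const (x c : ℕ)
  /-- `v x := v y + v z` -/
  | add (x y z : ℕ)
  /-- `v x := a k (v y)` -/
  | load (x : ℕ) (k : Fin 6) (y : ℕ)
  /-- `a k (v x) := v y` -/
  | store (k : Fin 6) (x y : ℕ)
  /-- `v x :=` entry `v y` of the input of natural numbers -/
  | read (x y : ℕ)
  /-- `v x := v y - v z` -/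
  | sub (x y z : ℕ)
  /-- `r x := 0` -/
  | rzero (x : ℕ)
  /-- `r x := r y + r z` -/
  | radd (x y z : ℕ)
  /-- `r x := r y - r z` -/
  | rsub (x y z : ℕ)
  /-- `r x := ra k (v y)` -/
  | rload (x : ℕ) (k : Fin 6) (y : ℕ)
  /-- `ra k (v x) := r y` -/
  | rstore (k : Fin 6) (x y : ℕ)
  /-- `r x :=` entry `v y` of the input of real numbers -/
  | rread (x y : ℕ)

/-- Put the address of entry `v y` of array `k` into the cell `7`. -/
def addressCode (k : Fin 6) (y : ℕ) : List Instr :=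
  -- There is no multiplication: the factor `8` comes from three doublings.
  [.add 7 (8 * y) (8 * y), .add 7 7 7, .add 7 7 7, .const 15 (k + 1), .add 7 7 15]

/-- The instructions for an operation. -/
def Op.code : Op → List Instr
  | .const x c => [.const (8 * x) c]
  | .add x y z => [.add (8 * x) (8 * y) (8 * z)]
  | .sub x y z => [.sub (8 * x) (8 * y) (8 * z)]
  | .load x k y => addressCode k y ++ [.load (8 * x) 7]
  | .store k x y => addressCode k x ++ [.store 7 (8 * y)]
  | .read x y => [.read (8 * x) (8 * y)]
  | .rzero x => [.rzero (8 * x)]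
  | .radd x y z => [.radd (8 * x) (8 * y) (8 * z)]
  | .rsub x y z => [.rsub (8 * x) (8 * y) (8 * z)]
  | .rload x k y => addressCode k y ++ [.rload (8 * x) 7]
  | .rstore k x y => addressCode k x ++ [.rstore 7 (8 * y)]
  | .rread x y => [.rread (8 * x) (8 * y)]

/-- The effect of an operation. -/
noncomputable def Op.apply (inN : List ℕ) (inR : List ℝ) (s : State) : Op → State
  | .const x c => { s with v := Function.update s.v x c }
  | .add x y z => { s with v := Function.update s.v x (s.v y + s.v z) }
  | .sub x y z => { s with v := Function.update s.v x (s.v y - s.v z) }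
  | .load x k y => { s with v := Function.update s.v x (s.a k (s.v y)) }
  | .store k x y =>
    { s with a := Function.update s.a k (Function.update (s.a k) (s.v x) (s.v y)) }
  | .read x y => { s with v := Function.update s.v x (inN.getD (s.v y) 0) }
  | .rzero x => { s with r := Function.update s.r x 0 }
  | .radd x y z => { s with r := Function.update s.r x (s.r y + s.r z) }
  | .rsub x y z => { s with r := Function.update s.r x (s.r y - s.r z) }
  | .rload x k y => { s with r := Function.update s.r x (s.ra k (s.v y)) }
  | .rstore k x y =>
    { s with ra := Function.update s.ra k (Function.update (s.ra k) (s.v x) (s.r y)) }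
  | .rread x y => { s with r := Function.update s.r x (inR.getD (s.v y) 0) }

/-- Structured programs. -/
inductive Cmd where
  | block (ops : List Op)
  | seq (c d : Cmd)
  /-- `if v x < v y then c else d` -/
  | ifLt (x y : ℕ) (c d : Cmd)
  /-- `while v x < v y do c` -/
  | whileLt (x y : ℕ) (c : Cmd)

/-- The number of instructions of a structured program. -/
def Cmd.size : Cmd → ℕ
  | .block ops => (ops.flatMap Op.code).length
  | .seq c d => c.size + d.size
  | .ifLt _ _ c d => c.size + d.size + 2
  | .whileLt _ _ c => c.size + 2

/-- The instructions of a structured program that begins at the instruction `l`. -/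
def Cmd.compile : Cmd → ℕ → List Instr
  | .block ops, _ => ops.flatMap Op.code
  | .seq c d, l => c.compile l ++ d.compile (l + c.size)
  -- The test jumps away when the strict inequality fails; `.jle 0 0` is an unconditional jump.
  | .ifLt x y c d, l => [.jle (8 * y) (8 * x) (l + c.size + 2)] ++ c.compile (l + 1) ++
      [.jle 0 0 (l + c.size + d.size + 2)] ++ d.compile (l + c.size + 2)
  | .whileLt x y c, l => [.jle (8 * y) (8 * x) (l + c.size + 2)] ++ c.compile (l + 1) ++
      [.jle 0 0 l]

lemma Cmd.length_compile (c : Cmd) (l : ℕ) : (c.compile l).length = c.size := by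
  induction c generalizing l with
  | block ops => rfl
  | seq c d hc hd => simp [compile, size, hc, hd]
  | ifLt x y c d hc hd => simp [compile, size, hc, hd]; omega
  | whileLt x y c hc => simp [compile, size, hc]

/-- The list of instructions `L` is the part of `P` that begins at the instruction `l`. -/
def IsPart (P : Program) (l : ℕ) (L : List Instr) : Prop :=
  ∃ A B, P = A ++ L ++ B ∧ A.length = l

lemma IsPart.left {P : Program} {l : ℕ} {L L' : List Instr} (h : IsPart P l (L ++ L')) :
    IsPart P l L := by
  obtain ⟨A, B, rfl, rfl⟩ := h
  exact ⟨A, L' ++ B, by simp, rfl⟩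

lemma IsPart.right {P : Program} {l l' : ℕ} {L L' : List Instr} (h : IsPart P l (L ++ L'))
    (hl : l + L.length = l') : IsPart P l' L' := by
  obtain ⟨A, B, rfl, rfl⟩ := h
  exact ⟨A ++ L, B, by simp, by simpa using hl⟩

lemma IsPart.getElem? {P : Program} {l : ℕ} {i : Instr} {L : List Instr}
    (h : IsPart P l (i :: L)) : P[l]? = some i := by
  obtain ⟨A, B, rfl, rfl⟩ := h
  simp

variable {inN : List ℕ} {inR : List ℝ}

lemma step_eq_exec {P : Program} {l : ℕ} {i : Instr} (h : P[l]? = some i) (M : Memory) :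
    step P inN inR ⟨l, M⟩ = exec inN inR ⟨l, M⟩ i := by
  simp [step, h]

/-- The effect of an instruction on the memory. -/
noncomputable def effect (inN : List ℕ) (inR : List ℝ) (M : Memory) (i : Instr) : Memory :=
  (exec inN inR ⟨0, M⟩ i).mem

/-- The instruction is not a jump. -/
def Instr.IsStraight : Instr → Prop
  | .jle _ _ _ => False
  | _ => True

lemma exec_of_isStraight {i : Instr} (h : i.IsStraight) (l : ℕ) (M : Memory) :
    exec inN inR ⟨l, M⟩ i = ⟨l + 1, effect inN inR M i⟩ := by
  cases i <;> first | rfl | exact h.elim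

lemma iterate_step_of_isStraight {P : Program} {l : ℕ} {L : List Instr} (hP : IsPart P l L)
    (hL : ∀ i ∈ L, i.IsStraight) (M : Memory) :
    (step P inN inR)^[L.length] ⟨l, M⟩ = ⟨l + L.length, L.foldl (effect inN inR) M⟩ := by
  induction L generalizing l M with
  | nil => rfl
  | cons i L ih =>
    rw [List.length_cons, Function.iterate_succ_apply, step_eq_exec hP.getElem?,
      exec_of_isStraight (hL i (by simp)), ih (IsPart.right (L := [i]) (l' := l + 1) hP rfl)
        (fun j hj => hL j (by simp [hj])), List.foldl_cons]
    congr 1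
    omega

lemma Op.isStraight_code (o : Op) : ∀ i ∈ o.code, i.IsStraight := by
  cases o <;> simp [code, addressCode, Instr.IsStraight]

lemma Op.length_code_le (o : Op) : o.code.length ≤ 6 := by
  cases o <;> simp [code, addressCode]

/-- Registers and the six arrays occupy different residues modulo `8`, so a write changes a single
register or entry. The scratch cells have residue `7`, which `Memory.view` does not see. -/
lemma Op.view_foldl_code (o : Op) (M : Memory) :
    (o.code.foldl (effect inN inR) M).view = o.apply inN inR M.view := by
  cases o <;> ext <;>
    simp only [code, addressCode, apply, effect, exec, Memory.view, Memory.setNat, Memory.setReal,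
      List.cons_append, List.nil_append, List.foldl_cons, List.foldl_nil, Function.update_apply, ite_apply] <;>
    grind

lemma Cmd.view_foldl_block (ops : List Op) (M : Memory) :
    ((ops.flatMap Op.code).foldl (effect inN inR) M).view =
      ops.foldl (Op.apply inN inR) M.view := by
  induction ops generalizing M with
  | nil => rfl
  | cons o ops ih => rw [List.flatMap_cons, List.foldl_append, ih, Op.view_foldl_code]; rfl

/-- Started in the state `s`, the structured program `c` ends, after a time and in a state
that satisfy `Q`. -/
def Wp (inN : List ℕ) (inR : List ℝ) (c : Cmd) (s : State) (Q : ℕ → State → Prop) : Prop :=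
  ∀ (P : Program) (l : ℕ), IsPart P l (c.compile l) → ∀ M : Memory, M.view = s →
    ∃ t M', (step P inN inR)^[t] ⟨l, M⟩ = ⟨l + c.size, M'⟩ ∧ Q t M'.view

lemma Wp.mono {c : Cmd} {s : State} {Q Q' : ℕ → State → Prop} (h : Wp inN inR c s Q)
    (hQ : ∀ t s, Q t s → Q' t s) : Wp inN inR c s Q' := by
  intro P l hP M hM
  obtain ⟨t, M', h1, h2⟩ := h P l hP M hM
  exact ⟨t, M', h1, hQ _ _ h2⟩

lemma wp_block {ops : List Op} {s : State} {Q : ℕ → State → Prop}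
    (h : ∀ t ≤ 6 * ops.length, Q t (ops.foldl (Op.apply inN inR) s)) :
    Wp inN inR (.block ops) s Q := by
  rintro P l hP M rfl
  refine ⟨_, _, iterate_step_of_isStraight hP ?_ M, ?_⟩
  · intro i hi
    obtain ⟨o, _, ho⟩ := List.mem_flatMap.1 hi
    exact o.isStraight_code i ho
  · rw [Cmd.compile, Cmd.view_foldl_block]
    refine h _ ?_
    clear h hP
    induction ops with
    | nil => simp
    | cons o ops ih =>
      have := o.length_code_le
      rw [List.flatMap_cons, List.length_append, List.length_cons]
      omega

lemma wp_seq {c d : Cmd} {s : State} {Q : ℕ → State → Prop}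
    (h : Wp inN inR c s fun t s' => Wp inN inR d s' fun t' s'' => Q (t + t') s'') :
    Wp inN inR (.seq c d) s Q := by
  intro P l hP M hM
  obtain ⟨t, M', h1, h2⟩ := h P l hP.left M hM
  obtain ⟨t', M'', h3, h4⟩ := h2 P _ (hP.right (by rw [Cmd.length_compile])) M' rfl
  refine ⟨t + t', M'', ?_, h4⟩
  rw [add_comm, Function.iterate_add_apply, h1, h3, add_assoc]
  rfl

/-- The first branch pays for the test and the jump over the second branch, the second branch for
the test only. -/
lemma wp_ifLt {x y : ℕ} {c d : Cmd} {s : State} {Q : ℕ → State → Prop}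
    (h₁ : s.v x < s.v y → Wp inN inR c s fun t s' => Q (t + 2) s')
    (h₂ : ¬ s.v x < s.v y → Wp inN inR d s fun t s' => Q (t + 1) s') :
    Wp inN inR (.ifLt x y c d) s Q := by
  rintro P l hP M rfl
  have hjump := step_eq_exec (inN := inN) (inR := inR) hP.left.left.left.getElem? M
  by_cases hlt : M.nat (8 * x) < M.nat (8 * y)
  · obtain ⟨t, M', h3, h4⟩ := h₁ hlt P (l + 1) (hP.left.left.right rfl) M rfl
    refine ⟨t + 2, M', ?_, h4⟩
    have hback : P[l + 1 + c.size]? = some (.jle 0 0 (l + c.size + d.size + 2)) :=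
      (hP.left.right (by simp [Cmd.length_compile]; omega)).getElem?
    rw [Function.iterate_succ_apply', Function.iterate_succ_apply, hjump]
    simp only [exec]
    rw [if_neg (not_le.2 hlt), h3, step_eq_exec hback]
    simp only [exec, le_refl, if_true, Cmd.size]
    congr 1
    omega
  · obtain ⟨t, M', h3, h4⟩ := h₂ hlt P (l + c.size + 2)
      (hP.right (by simp [Cmd.length_compile]; omega)) M rfl
    refine ⟨t + 1, M', ?_, h4⟩
    rw [Function.iterate_succ_apply, hjump]
    simp only [exec]
    rw [if_pos (not_lt.1 hlt), h3, Cmd.size]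
    congr 1
    omega

/-- The rule for loops: the invariant `I` is preserved, and every iteration is paid for by the
decrease of the potential `p`. -/
lemma wp_whileLt {x y : ℕ} {c : Cmd} {s : State} {Q : ℕ → State → Prop} (I : State → Prop)
    (p : State → ℕ) (hbody : ∀ s, I s → s.v x < s.v y →
      Wp inN inR c s fun t s' => I s' ∧ p s' + t + 2 ≤ p s)
    (hs : I s) (hQ : ∀ t s', t ≤ p s + 1 → I s' → ¬ s'.v x < s'.v y → Q t s') :
    Wp inN inR (.whileLt x y c) s Q := by
  intro P l hP
  -- Induction on a bound for the potential. An iteration costs its body, the test and the jump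
  -- back; the final failing test is the extra `1`.
  have key : ∀ b : ℕ, ∀ M : Memory, p M.view ≤ b → I M.view → ∃ t M',
      (step P inN inR)^[t] ⟨l, M⟩ = ⟨l + (c.size + 2), M'⟩ ∧ t ≤ p M.view + 1 ∧
        I M'.view ∧ ¬ M'.view.v x < M'.view.v y := by
    intro b
    induction b with
    | zero =>
      intro M hb hI
      by_cases hlt : M.nat (8 * x) < M.nat (8 * y)
      · obtain ⟨t, M', _, _, h⟩ := hbody _ hI hlt P (l + 1) (hP.left.right rfl) M rfl
        omega
      · refine ⟨1, M, ?_, by omega, hI, hlt⟩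
        rw [Function.iterate_one, step_eq_exec hP.left.left.getElem?]
        simp only [exec]
        rw [if_pos (not_lt.1 hlt)]
        rfl
    | succ b ih =>
      intro M hb hI
      have hjump := step_eq_exec (inN := inN) (inR := inR) hP.left.left.getElem? M
      by_cases hlt : M.nat (8 * x) < M.nat (8 * y)
      · obtain ⟨t, M', h1, h2, h3⟩ := hbody _ hI hlt P (l + 1) (hP.left.right rfl) M rfl
        obtain ⟨t', M'', h4, h5, h6⟩ := ih M' (by omega) h2
        refine ⟨t' + 1 + t + 1, M'', ?_, by omega, h6⟩
        have hback : P[l + 1 + c.size]? = some (.jle 0 0 l) :=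
          (hP.right (by simp [Cmd.length_compile]; omega)).getElem?
        rw [Function.iterate_succ_apply, hjump]
        simp only [exec]
        rw [if_neg (not_le.2 hlt), Function.iterate_add_apply, h1, Function.iterate_succ_apply,
          step_eq_exec hback]
        simp only [exec, le_refl, if_true]
        exact h4
      · refine ⟨1, M, ?_, by omega, hI, hlt⟩
        rw [Function.iterate_one, hjump]
        simp only [exec]
        rw [if_pos (not_lt.1 hlt)]
        rfl
  rintro M rfl
  obtain ⟨t, M', h1, h2, h3, h4⟩ := key _ M le_rfl hs
  exact ⟨t, M', h1, hQ _ _ h2 h3 h4⟩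

lemma Wp.exists_haltsWithin {c : Cmd} {M : Memory} {Q : ℕ → State → Prop}
    (h : Wp inN inR c M.view Q) :
    ∃ t M', HaltsWithin (c.compile 0) inN inR M t M' ∧ Q t M'.view := by
  obtain ⟨t, M', h1, h2⟩ := h (c.compile 0) 0 ⟨[], [], by simp, rfl⟩ M rfl
  exact ⟨t, M', ⟨_, by simp [Cmd.length_compile], h1⟩, h2⟩

lemma HaltsWithin.mono {P : Program} {M M' : Memory} {t t' : ℕ}
    (h : HaltsWithin P inN inR M t M') (ht : t ≤ t') : HaltsWithin P inN inR M t' M' := by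
  obtain ⟨pc, h1, h2⟩ := h
  refine ⟨pc, h1, ?_⟩
  obtain ⟨k, rfl⟩ := Nat.exists_eq_add_of_le ht
  rw [add_comm, Function.iterate_add_apply, h2]
  apply Function.iterate_fixed
  simp [step, h1]

end RealRAM

namespace PlaneGraph

open Finset

variable {n D : ℕ} (G : PlaneGraph n D) (x₀ : Fin n) (walks : List (List (Fin D)))

/-! ### Reading the input of the preprocessing -/

lemma getD_ofFn_append {m : ℕ} (f : Fin m → ℕ) (L : List ℕ) (i : Fin m) :
    (List.ofFn f ++ L).getD i 0 = f i := by
  rw [List.getD_append _ _ _ _ (by simp)]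
  simp

lemma getD_append_add {L L' : List ℕ} {m : ℕ} (h : L.length = m) (i : ℕ) :
    (L ++ L').getD (m + i) 0 = L'.getD i 0 := by
  rw [List.getD_append_right _ _ _ _ (by omega)]
  congr 1
  omega

/-- The part of the input that describes a list of walks. -/
def encodeWalks (walks : List (List (Fin D))) : List ℕ :=
  walks.flatMap (fun π => π.length :: π.map (fun d : Fin D => (d : ℕ)))

lemma encode_eq : G.encode x₀ walks = [n, D, (x₀ : ℕ), walks.length] ++
    (List.ofFn (fun d => (G.tail d : ℕ)) ++ (List.ofFn (fun d => (G.rev d : ℕ)) ++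
      (List.ofFn (fun d => (G.rot d : ℕ)) ++ encodeWalks walks))) := by
  simp [encode, encodeWalks, List.map_eq_flatMap]

lemma encode_tail (d : Fin D) : (G.encode x₀ walks).getD (4 + d) 0 = G.tail d := by
  rw [encode_eq, getD_append_add (by simp), getD_ofFn_append]

lemma encode_rev (d : Fin D) : (G.encode x₀ walks).getD (4 + D + d) 0 = G.rev d := by
  rw [encode_eq, add_assoc, getD_append_add (by simp), getD_append_add (by simp),
    getD_ofFn_append]

lemma encode_rot (d : Fin D) : (G.encode x₀ walks).getD (4 + D + D + d) 0 = G.rot d := by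
  rw [encode_eq, add_assoc, add_assoc, getD_append_add (by simp), getD_append_add (by simp),
    getD_append_add (by simp), getD_ofFn_append]

lemma encode_walks (i : ℕ) :
    (G.encode x₀ walks).getD (4 + D + D + D + i) 0 = (encodeWalks walks).getD i 0 := by
  rw [encode_eq, add_assoc, add_assoc, add_assoc, getD_append_add (by simp),
    getD_append_add (by simp), getD_append_add (by simp), getD_append_add (by simp)]

end PlaneGraph

namespace RealRAM

open Finset

/-! ### The preprocessing program

Registers `0`, `1` hold the constants `0`, `1`; registers `2` to `5` hold the first four numbers of
the input; registers `6` to `9` hold the positions in the input of the tails, the reversals, the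
rotation and the walks. The arrays of natural numbers are: `0`, a dart for each vertex; `1`, marks
for the visited darts; `2`, a queue of darts; `3`, the parents of the darts; `4`, the positions of
the walks. The arrays of real numbers are: `0`, the weights that are still to be sent to the root;
`1`, the flow along the darts; `2`, the prefix sums of the flow along the walks. -/

open Op Cmd

def setupCmd : Cmd := .block
  [const 0 0, const 1 1, const 6 0, read 2 6, read 3 1, const 6 2, read 4 6, const 6 3, read 5 6,
    const 6 4, add 7 6 3, add 8 7 3, add 9 8 3, const 10 0]

/-- Choose a dart for each vertex. -/
def firstCmd : Cmd := .whileLt 10 3 (.block [add 11 6 10, read 12 11, store 0 12 10, add 10 10 1])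

/-- Put the weight of each vertex on its dart. -/
def weightCmd : Cmd := .seq (.block [const 10 0]) (.whileLt 10 2 (.block
  [rread 0 10, load 11 0 10, rload 1 0 11, radd 1 1 0, rstore 0 11 1, add 10 10 1]))

/-- Append the dart in register `14` to the queue, with the dart in register `13` as its parent,
if it has not been visited yet. -/
def visitCmd : Cmd := .seq (.block [load 15 1 14]) (.ifLt 15 1
  (.block [store 1 14 1, store 3 14 13, store 2 12 14, add 12 12 1]) (.block []))

/-- Breadth first search in the graph on the darts given by rotation and reversal. -/
def searchCmd : Cmd := .seq
  (.block [load 10 0 4, store 1 10 1, const 11 0, store 2 11 10, const 12 1])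
  (.whileLt 11 12 (.seq (.block [load 13 2 11, add 14 8 13, read 14 14]) (.seq visitCmd
    (.seq (.block [add 14 7 13, read 14 14]) (.seq visitCmd (.block [add 11 11 1]))))))

/-- Send all weights to the root of the search tree. -/
def flowCmd : Cmd := .seq
  (.whileLt 1 12 (.seq (.block
    [sub 12 12 1, load 13 2 12, load 14 3 13, rload 0 0 13, rload 1 0 14, radd 1 1 0, rstore 0 14 1,
      rload 1 0 13, rsub 1 1 0, rstore 0 13 1, add 15 7 14, read 15 15])
    (.ifLt 15 13 (.block []) (.ifLt 13 15 (.block []) (.block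
      [rload 1 1 14, radd 1 1 0, rstore 1 14 1, rload 1 1 13, rsub 1 1 0, rstore 1 13 1])))))
  (.block [rload 3 0 10])

/-- Compute the prefix sums of the flow along one walk. -/
def prefixWalkCmd : Cmd := .seq
  (.block [read 12 11, add 11 11 1, store 4 10 11, add 12 11 12])
  (.seq
    (.whileLt 11 12 (.block [read 13 11, rload 0 1 13, rload 1 2 11, radd 1 1 0, add 11 11 1,
      rstore 2 11 1]))
    (.block [add 10 10 1]))

def prefixCmd : Cmd := .seq (.block [const 10 0, add 11 9 0]) (.whileLt 10 5 prefixWalkCmd)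

def preprocessCmd : Cmd := .seq setupCmd (.ifLt 0 3
  (.seq firstCmd (.seq weightCmd (.seq searchCmd (.seq flowCmd prefixCmd)))) (.block []))

/-! ### Setup, a dart for each vertex, and the initial weights -/

section Preprocess

variable {n D : ℕ} {G : PlaneGraph n D} {x₀ : Fin n} {walks : List (List (Fin D))}

/-- The contents of the registers `0` to `9` during the preprocessing. -/
structure Header (x₀ : Fin n) (walks : List (List (Fin D))) (s : State) : Prop where
  v0 : s.v 0 = 0
  v1 : s.v 1 = 1
  v2 : s.v 2 = n
  v3 : s.v 3 = D
  v4 : s.v 4 = x₀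
  v5 : s.v 5 = walks.length
  v6 : s.v 6 = 4
  v7 : s.v 7 = 4 + D
  v8 : s.v 8 = 4 + D + D
  v9 : s.v 9 = 4 + D + D + D

lemma Header.of_eq {s s' : State} (h : Header x₀ walks s) (hs : ∀ i < 10, s'.v i = s.v i) :
    Header x₀ walks s' := by
  constructor <;> rw [hs _ (by norm_num)]
  exacts [h.v0, h.v1, h.v2, h.v3, h.v4, h.v5, h.v6, h.v7, h.v8, h.v9]

lemma wp_setupCmd {inR : List ℝ} :
    Wp (G.encode x₀ walks) inR setupCmd Memory.zero.view fun t s => t ≤ 84 ∧ Header x₀ walks s ∧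
      s.v 10 = 0 ∧ (∀ k i, s.a k i = 0) ∧ ∀ k i, s.ra k i = 0 := by
  refine wp_block fun t ht => ⟨ht, ?_, ?_, ?_, ?_⟩
  · constructor <;> simp [Op.apply, PlaneGraph.encode_eq]
  · simp [Op.apply]
  · simp [Op.apply, Memory.view, Memory.zero]
  · simp [Op.apply, Memory.view, Memory.zero]

lemma wp_firstCmd {inR : List ℝ} (hD : 0 < D) {s₀ : State} (h : Header x₀ walks s₀)
    (h10 : s₀.v 10 = 0) (ha : ∀ k i, s₀.a k i = 0) (hra : ∀ k i, s₀.ra k i = 0) :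
    Wp (G.encode x₀ walks) inR firstCmd s₀ fun t s => t ≤ 26 * D + 1 ∧ Header x₀ walks s ∧
      (∃ first : Fin n → Fin D, (∀ v, G.tail (first v) = v) ∧ ∀ v : Fin n, s.a 0 v = first v) ∧
      (∀ k i, k ≠ 0 → s.a k i = 0) ∧ ∀ k i, s.ra k i = 0 := by
  -- Entries may be overwritten, so the invariant only asks for some dart with the right tail. The
  -- factor `26` is four operations of at most six instructions plus two jumps; the other loop
  -- constants arise in the same way.
  refine wp_whileLt (fun s => Header x₀ walks s ∧ s.v 10 ≤ D ∧
    (∀ d : Fin D, (d : ℕ) < s.v 10 → ∃ e : Fin D, G.tail e = G.tail d ∧ s.a 0 (G.tail d) = e) ∧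
    (∀ k i, k ≠ 0 → s.a k i = 0) ∧ ∀ k i, s.ra k i = 0) (fun s => 26 * (D - s.v 10)) ?_ ?_ ?_
  · rintro s ⟨hs, h1, h2, h3, h4⟩ hlt
    rw [hs.v3] at hlt
    have hread := G.encode_tail x₀ walks ⟨s.v 10, hlt⟩
    simp only at hread
    refine wp_block fun t ht => ?_
    simp only [List.foldl_cons, List.foldl_nil, Op.apply, Function.update_apply, List.length_cons,
      List.length_nil] at ht ⊢
    simp only [reduceIte, Nat.reduceEqDiff, hs.v6, hs.v1, hread]
    refine ⟨⟨hs.of_eq fun i hi => ?_, hlt, ?_, ?_, h4⟩, by omega⟩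
    · grind
    · intro d hd
      by_cases htail : G.tail d = G.tail ⟨s.v 10, hlt⟩
      · exact ⟨_, htail.symm, by simp [htail]⟩
      · obtain ⟨e, he, he'⟩ := h2 d (lt_of_le_of_ne (Nat.lt_succ_iff.1 hd) fun hd' =>
          htail (congrArg G.tail (Fin.ext hd')))
        refine ⟨e, he, ?_⟩
        have : (G.tail d : ℕ) ≠ G.tail ⟨s.v 10, hlt⟩ := fun h => htail (Fin.ext h)
        simp [this, he']
    · intro k i hk
      simp [hk, h3]
  · exact ⟨h, by omega, fun d hd => by omega, fun k i _ => ha k i, hra⟩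
  · rintro t s ht ⟨hs, h1, h2, h3, h4⟩ hlt
    rw [hs.v3] at hlt
    refine ⟨by omega, hs, ?_, h3, h4⟩
    have : ∀ v, ∃ e : Fin D, G.tail e = v ∧ s.a 0 v = e := by
      intro v
      obtain ⟨d, rfl⟩ := G.exists_tail_eq hD v
      exact h2 d (by omega)
    choose first hf using this
    exact ⟨first, fun v => (hf v).1, fun v => (hf v).2⟩

lemma wp_weightCmd {inN : List ℕ} {ω : Fin n → ℝ} {first : Fin n → Fin D} {s₀ : State}
    (h : Header x₀ walks s₀) (hfirst : ∀ v : Fin n, s₀.a 0 v = first v)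
    (ha : ∀ k i, k ≠ 0 → s₀.a k i = 0) (hra : ∀ k i, s₀.ra k i = 0) :
    Wp inN (List.ofFn ω) weightCmd s₀ fun t s => t ≤ 38 * n + 7 ∧ Header x₀ walks s ∧
      (∀ v : Fin n, s.a 0 v = first v) ∧ (∀ k i, k ≠ 0 → s.a k i = 0) ∧
      (∀ k i, k ≠ 0 → s.ra k i = 0) ∧
      ∀ f : Fin D → ℝ, ∑ d : Fin D, s.ra 0 d * f d = ∑ v, ω v * f (first v) := by
  refine wp_seq (wp_block fun t₀ ht₀ => ?_)
  -- The weights on the darts are described by their pairing with an arbitrary `f`, the form in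
  -- which the flow computation uses them.
  refine wp_whileLt (fun s => Header x₀ walks s ∧ s.v 10 ≤ n ∧ (∀ v : Fin n, s.a 0 v = first v) ∧
    (∀ k i, k ≠ 0 → s.a k i = 0) ∧ (∀ k i, k ≠ 0 → s.ra k i = 0) ∧
      ∀ f : Fin D → ℝ, ∑ d : Fin D, s.ra 0 d * f d =
        ∑ v : Fin n, if (v : ℕ) < s.v 10 then ω v * f (first v) else 0)
    (fun s => 38 * (n - s.v 10)) ?_ ?_ ?_
  · rintro s ⟨hs, h1, h2, h3, h4, h5⟩ hlt
    rw [hs.v2] at hlt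
    have hread : (List.ofFn ω).getD (s.v 10) 0 = ω ⟨s.v 10, hlt⟩ := by simp [hlt]
    have hload := h2 ⟨s.v 10, hlt⟩
    simp only at hload
    refine wp_block fun t ht => ?_
    simp only [List.foldl_cons, List.foldl_nil, Op.apply, Function.update_apply, List.length_cons,
      List.length_nil] at ht ⊢
    simp only [reduceIte, Nat.reduceEqDiff, hs.v1, hread, hload]
    refine ⟨⟨hs.of_eq fun i hi => ?_, hlt, h2, h3, ?_, ?_⟩, by omega⟩
    · grind
    · intro k i hk
      simp [hk, h4]
    · intro f
      have h6 : ∀ d : Fin D, Function.update (s.ra 0) (first ⟨s.v 10, hlt⟩ : ℕ)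
          (s.ra 0 (first ⟨s.v 10, hlt⟩) + ω ⟨s.v 10, hlt⟩) d * f d = s.ra 0 d * f d +
            if d = first ⟨s.v 10, hlt⟩ then ω ⟨s.v 10, hlt⟩ * f d else 0 := by
        intro d
        rw [Function.update_apply]
        by_cases hd : d = first ⟨s.v 10, hlt⟩
        · simp [hd, add_mul]
        · simp [hd, Fin.val_inj]
      have h7 : ∀ v : Fin n, (if (v : ℕ) < s.v 10 + 1 then ω v * f (first v) else 0) =
          (if (v : ℕ) < s.v 10 then ω v * f (first v) else 0) +
            if v = ⟨s.v 10, hlt⟩ then ω v * f (first v) else 0 := by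
        intro v
        rcases lt_trichotomy (v : ℕ) (s.v 10) with h8 | h8 | h8
        · simp [h8, Nat.lt_succ_of_lt h8, Fin.ext_iff, h8.ne]
        · simp [h8, Fin.ext_iff]
        · simp [h8.not_gt, Fin.ext_iff, h8.ne', show ¬ (v : ℕ) < s.v 10 + 1 by omega]
      rw [sum_congr rfl fun d _ => h6 d, sum_congr rfl fun v _ => h7 v, sum_add_distrib,
        sum_add_distrib, h5]
      simp
  · refine ⟨h.of_eq fun i hi => ?_, ?_, ?_⟩
    · simp [Op.apply, hi.ne]
    · simp [Op.apply]
    · refine ⟨hfirst, ha, fun k i _ => hra k i, fun f => ?_⟩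
      simp [Op.apply, hra]
  · rintro t s ht ⟨hs, h1, h2, h3, h4, h5⟩ hlt
    rw [hs.v2] at hlt
    simp only [List.length_cons, List.length_nil] at ht₀
    refine ⟨by omega, hs, h2, h3, h4, fun f => ?_⟩
    rw [h5]
    exact sum_congr rfl fun v _ => if_pos (by omega)

end Preprocess

end RealRAM

namespace RealRAM

open Finset

/-! ### Breadth-first search on the darts -/

section Search

variable {n D : ℕ} {G : PlaneGraph n D} {x₀ : Fin n} {walks : List (List (Fin D))}

/-- The list `l` of darts, in reverse order, is the contents of `queue`; it begins with `root`, and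
each further dart is the image of its parent, which precedes it, under rotation or reversal. -/
inductive SearchTree (G : PlaneGraph n D) (root : Fin D) (queue parent : ℕ → ℕ) :
    List (Fin D) → Prop
  | single : queue 0 = root → SearchTree G root queue parent [root]
  | cons {d p : Fin D} {l : List (Fin D)} : queue l.length = d → d ∉ l → p ∈ l → parent d = p →
      (d = G.rot p ∨ d = G.rev p) → SearchTree G root queue parent l →
      SearchTree G root queue parent (d :: l)

namespace SearchTree

open Finset

variable {root : Fin D} {queue parent queue' parent' : ℕ → ℕ} {l : List (Fin D)}

lemma congr (h : SearchTree G root queue parent l) (hq : ∀ k < l.length, queue' k = queue k)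
    (hp : ∀ d ∈ l, parent' (d : Fin D) = parent d) : SearchTree G root queue' parent' l := by
  induction h with
  | single h => exact single (by rw [hq 0 (by simp), h])
  | cons h1 h2 h3 h4 h5 _ ih =>
    exact cons (by rw [hq _ (by simp), h1]) h2 h3 (by rw [hp _ (by simp), h4]) h5
      (ih (fun k hk => hq k (by simp; omega)) (fun d hd => hp d (by simp [hd])))

lemma nodup (h : SearchTree G root queue parent l) : l.Nodup := by
  induction h with
  | single h => simp
  | cons _ h2 _ _ _ _ ih => exact List.nodup_cons.2 ⟨h2, ih⟩

lemma root_mem (h : SearchTree G root queue parent l) : root ∈ l := by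
  induction h with
  | single h => simp
  | cons _ _ _ _ _ _ ih => exact List.mem_cons_of_mem _ ih

lemma exists_mem (h : SearchTree G root queue parent l) {k : ℕ} (hk : k < l.length) :
    ∃ d ∈ l, queue k = (d : Fin D) := by
  induction h with
  | single h => exact ⟨root, by simp, by rw [show k = 0 by simpa using hk, h]⟩
  | @cons d _ l h1 _ _ _ _ _ ih =>
    rcases Nat.lt_succ_iff_lt_or_eq.1 hk with hk | rfl
    · obtain ⟨e, he, he'⟩ := ih hk
      exact ⟨e, List.mem_cons_of_mem _ he, he'⟩
    · exact ⟨d, by simp, h1⟩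

lemma exists_queue_eq (h : SearchTree G root queue parent l) {d : Fin D} (hd : d ∈ l) :
    ∃ k < l.length, queue k = d := by
  induction h with
  | single h => exact ⟨0, by simp, by rw [List.mem_singleton.1 hd, h]⟩
  | @cons e _ l h1 _ _ _ _ _ ih =>
    rcases List.mem_cons.1 hd with rfl | hd
    · exact ⟨l.length, by simp, h1⟩
    · obtain ⟨k, hk, hk'⟩ := ih hd
      exact ⟨k, by simp; omega, hk'⟩

lemma length_le (h : SearchTree G root queue parent l) : l.length ≤ D := by
  simpa using h.nodup.length_le_card

end SearchTree

/-- The state of the search after the darts of `l` have been visited. -/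
structure Visited (G : PlaneGraph n D) (root : Fin D) (l : List (Fin D)) (s : State) : Prop where
  tree : SearchTree G root (s.a 2) (s.a 3) l
  mark : ∀ d : Fin D, s.a 1 d = if d ∈ l then 1 else 0
  tail : s.v 12 = l.length

lemma wp_visitCmd {inN : List ℕ} {inR : List ℝ} {root d p : Fin D} {l : List (Fin D)} {s : State}
    (h : Visited G root l s) (h1 : s.v 1 = 1) (hd : s.v 14 = d) (hp : s.v 13 = p) (hpl : p ∈ l)
    (hdp : d = G.rot p ∨ d = G.rev p) :
    Wp inN inR visitCmd s fun t s' => t ≤ 32 ∧ (∃ l', Visited G root l' s' ∧ l ⊆ l' ∧ d ∈ l' ∧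
        l.length ≤ l'.length) ∧
      (∀ i, i ≠ 12 → i ≠ 15 → s'.v i = s.v i) ∧ s'.ra = s.ra ∧
      ∀ k < l.length, s'.a 2 k = s.a 2 k := by
  refine wp_seq (wp_block fun t₀ ht₀ => ?_)
  simp only [List.length_cons, List.length_nil] at ht₀
  simp only [List.foldl_cons, List.foldl_nil, Op.apply]
  refine wp_ifLt (fun hlt => wp_block fun t ht => ?_) (fun hlt => wp_block fun t ht => ?_)
  · simp only [List.length_cons, List.length_nil] at ht
    simp only [Function.update_apply, reduceIte, Nat.reduceEqDiff, hd, h.mark, h1] at hlt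
    have hdl : d ∉ l := fun hdl => by simp [hdl] at hlt
    simp only [List.foldl_cons, List.foldl_nil, Op.apply, Function.update_apply]
    simp only [reduceIte, Nat.reduceEqDiff, hd, hp, h.tail, h1]
    refine ⟨by omega, ⟨d :: l, ⟨?_, ?_, ?_⟩, by simp, by simp, by simp⟩, ?_, trivial, ?_⟩
    · refine SearchTree.cons (p := p) (by simp) hdl hpl (by simp) hdp (h.tree.congr ?_ ?_)
      · intro k hk
        simp [hk.ne]
      · intro e he
        have : (e : ℕ) ≠ d := fun hed => hdl (Fin.ext hed ▸ he)
        simp [this]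
    · intro e
      by_cases hed : e = d
      · simp [hed]
      · simp [hed, Fin.val_inj, h.mark]
    · simp
    · intro i hi hi'
      simp [hi, hi']
    · intro k hk
      simp [hk.ne]
  · simp only [List.length_nil] at ht
    simp only [Function.update_apply, reduceIte, Nat.reduceEqDiff, hd, h.mark, h1] at hlt
    have hdl : d ∈ l := by
      by_contra hdl
      simp [hdl] at hlt
    refine ⟨by omega, ⟨l, ⟨h.tree, h.mark, ?_⟩, by simp, hdl, le_rfl⟩, ?_, rfl, fun _ _ => rfl⟩
    · simp [h.tail]
    · intro i hi hi'
      simp [hi']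

/-- The invariant of the search: the darts before position `v 11` in the queue have been
processed. -/
structure Searching (G : PlaneGraph n D) (x₀ : Fin n) (walks : List (List (Fin D))) (root : Fin D)
    (ra : Fin 6 → ℕ → ℝ) (l : List (Fin D)) (s : State) : Prop where
  header : Header x₀ walks s
  root_eq : s.v 10 = root
  ra : s.ra = ra
  visited : Visited G root l s
  le : s.v 11 ≤ l.length
  closed : ∀ k < s.v 11, ∀ d : Fin D, s.a 2 k = d → G.rot d ∈ l ∧ G.rev d ∈ l

lemma wp_searchStep {inR : List ℝ} {root : Fin D} {ra : Fin 6 → ℕ → ℝ} {l : List (Fin D)}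
    {s : State} (h : Searching G x₀ walks root ra l s) (hlt : s.v 11 < s.v 12) :
    Wp (G.encode x₀ walks) inR (.seq (.block [.load 13 2 11, .add 14 8 13, .read 14 14])
      (.seq visitCmd (.seq (.block [.add 14 7 13, .read 14 14])
        (.seq visitCmd (.block [.add 11 11 1]))))) s fun t s' =>
      t ≤ 100 ∧ s'.v 11 = s.v 11 + 1 ∧ ∃ l', Searching G x₀ walks root ra l' s' := by
  have hs := h.header
  rw [h.visited.tail] at hlt
  obtain ⟨d, hdl, hd⟩ := h.visited.tree.exists_mem hlt
  refine wp_seq (wp_block fun t₁ ht₁ => ?_)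
  simp only [List.length_cons, List.length_nil] at ht₁
  simp only [List.foldl_cons, List.foldl_nil, Op.apply, Function.update_apply]
  simp only [reduceIte, Nat.reduceEqDiff, hd, hs.v8, PlaneGraph.encode_rot]
  refine wp_seq ?_
  refine (wp_visitCmd (G := G) (root := root) (d := G.rot d) (p := d) (l := l)
    ?_ ?_ ?_ ?_ hdl (Or.inl rfl)).mono ?_
  · exact ⟨h.visited.tree, h.visited.mark, by simp [h.visited.tail]⟩
  · simp [hs.v1]
  · simp
  · simp
  rintro t₂ s₂ ⟨ht₂, ⟨l₂, hl₂, hsub₂, hmem₂, hlen₂⟩, hv₂, hra₂, hq₂⟩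
  simp only at hra₂ hq₂
  have hv₂' : ∀ i < 12, s₂.v i = s.v i := fun i hi => by
    rw [hv₂ i (by omega) (by omega)]
    simp [show i ≠ 13 by omega, show i ≠ 14 by omega]
  have h13 : s₂.v 13 = d := by
    rw [hv₂ _ (by norm_num) (by norm_num)]
    simp
  refine wp_seq (wp_block fun t₃ ht₃ => ?_)
  simp only [List.length_cons, List.length_nil] at ht₃
  simp only [List.foldl_cons, List.foldl_nil, Op.apply, Function.update_apply]
  simp only [reduceIte, h13, hv₂' 7 (by norm_num), hs.v7, PlaneGraph.encode_rev]
  refine wp_seq ?_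
  refine (wp_visitCmd (G := G) (root := root) (d := G.rev d) (p := d) (l := l₂)
    ?_ ?_ ?_ ?_ (hsub₂ hdl) (Or.inr rfl)).mono ?_
  · exact ⟨hl₂.tree, hl₂.mark, by simp [hl₂.tail]⟩
  · simp [hv₂' 1, hs.v1]
  · simp
  · simp [h13]
  rintro t₄ s₄ ⟨ht₄, ⟨l₄, hl₄, hsub₄, hmem₄, hlen₄⟩, hv₄, hra₄, hq₄⟩
  simp only at hra₄ hq₄
  have hv₄' : ∀ i < 12, s₄.v i = s.v i := fun i hi => by
    rw [hv₄ i (by omega) (by omega), ← hv₂' i hi]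
    simp [show i ≠ 14 by omega]
  have hq : ∀ k < l.length, s₄.a 2 k = s.a 2 k := fun k hk => by
    rw [hq₄ k (hk.trans_le hlen₂), hq₂ k hk]
  refine wp_block fun t₅ ht₅ => ?_
  simp only [List.length_cons, List.length_nil] at ht₅
  simp only [List.foldl_cons, List.foldl_nil, Op.apply, Function.update_self]
  rw [hv₄' 11 (by norm_num), hv₄' 1 (by norm_num), hs.v1]
  refine ⟨by omega, rfl, l₄, ⟨hs.of_eq fun i hi => ?_, ?_, ?_, ⟨hl₄.tree, hl₄.mark, ?_⟩, ?_, ?_⟩⟩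
  · simp [show i ≠ 11 by omega, hv₄' i (by omega)]
  · simp [hv₄' 10, h.root_eq]
  · rw [hra₄, hra₂, h.ra]
  · simp [hl₄.tail]
  · simp only [Function.update_self]
    omega
  · simp only [Function.update_self]
    intro k hk e he
    rw [hq k (by omega)] at he
    rcases Nat.lt_succ_iff_lt_or_eq.1 hk with hk | rfl
    · obtain ⟨h1, h2⟩ := h.closed k hk e he
      exact ⟨hsub₄ (hsub₂ h1), hsub₄ (hsub₂ h2)⟩
    · obtain rfl : d = e := Fin.ext (hd.symm.trans he)
      exact ⟨hsub₄ hmem₂, hmem₄⟩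

lemma wp_searchCmd {inR : List ℝ} {first : Fin n → Fin D} {s₀ : State}
    (h : Header x₀ walks s₀) (hfirst : ∀ v : Fin n, s₀.a 0 v = first v)
    (ha : ∀ k i, k ≠ 0 → s₀.a k i = 0) :
    Wp (G.encode x₀ walks) inR searchCmd s₀ fun t s => t ≤ 102 * D + 31 ∧ Header x₀ walks s ∧
      s.v 10 = first x₀ ∧ s.ra = s₀.ra ∧ ∃ l : List (Fin D), (∀ d, d ∈ l) ∧ s.v 12 = l.length ∧
        SearchTree G (first x₀) (s.a 2) (s.a 3) l := by
  refine wp_seq (wp_block fun t₀ ht₀ => ?_)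
  simp only [List.length_cons, List.length_nil] at ht₀
  refine wp_whileLt (fun s => ∃ l, Searching G x₀ walks (first x₀) s₀.ra l s)
    (fun s => 102 * (D - s.v 11)) ?_ ?_ ?_
  · rintro s ⟨l, hl⟩ hlt
    refine (wp_searchStep hl hlt).mono ?_
    rintro t s' ⟨h1, h2, h3⟩
    refine ⟨h3, ?_⟩
    have h4 := hl.visited.tree.length_le
    rw [hl.visited.tail] at hlt
    omega
  · refine ⟨[first x₀], h.of_eq fun i hi => ?_, ?_, rfl, ⟨SearchTree.single ?_, ?_, ?_⟩, ?_, ?_⟩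
    · simp [Op.apply, show i ≠ 10 by omega, show i ≠ 11 by omega,
        show i ≠ 12 by omega]
    · simp [Op.apply, h.v4, hfirst]
    · simp [Op.apply, h.v4, hfirst]
    · intro d
      simp [Op.apply, Function.update_apply, h.v4, hfirst, h.v1, Fin.val_inj, ha]
    · simp [Op.apply]
    · simp [Op.apply]
    · simp [Op.apply]
  · rintro t s ht ⟨l, hl⟩ hlt
    have h4 := hl.visited.tree.length_le
    refine ⟨by omega, hl.header, hl.root_eq, hl.ra, l, fun d => ?_, hl.visited.tail, hl.visited.tree⟩
    have hclosed : ∀ e ∈ l, G.rot e ∈ l ∧ G.rev e ∈ l := by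
      intro e he
      obtain ⟨k, hk, hk'⟩ := hl.visited.tree.exists_queue_eq he
      rw [hl.visited.tail] at hlt
      exact hl.closed k (by omega) e hk'
    -- An injective map of a finite set into itself is onto. Hence membership in `l` is invariant
    -- under rotation and reversal in both directions, and connectedness puts every dart in `l`.
    have hsub : ∀ {f : Fin D → Fin D}, Function.Injective f → (∀ e ∈ l, f e ∈ l) →
        ∀ e, f e ∈ l ↔ e ∈ l := by
      intro f hf hfl e
      refine ⟨fun he => ?_, hfl e⟩
      have himg : l.toFinset.image f = l.toFinset := by
        refine eq_of_subset_of_card_le (fun x hx => ?_) (card_image_of_injective _ hf).ge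
        obtain ⟨y, hy, rfl⟩ := mem_image.1 hx
        exact List.mem_toFinset.2 (hfl y (List.mem_toFinset.1 hy))
      rw [← List.mem_toFinset, ← himg] at he
      obtain ⟨y, hy, hye⟩ := mem_image.1 he
      rw [← hf hye]
      exact List.mem_toFinset.1 hy
    have hmem := G.eq_of_invariant (f := fun e => e ∈ l)
      (fun e => propext (hsub G.rot.injective (fun e he => (hclosed e he).1) e))
      (fun e => propext (hsub G.rev_injective (fun e he => (hclosed e he).2) e)) (first x₀) d
    exact hmem ▸ hl.visited.tree.root_mem

end Search

/-! ### The flow that carries all weights to the root -/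

section Flow

variable {n D : ℕ} {G : PlaneGraph n D} {x₀ : Fin n} {walks : List (List (Fin D))}

/-- The flow `φ` along the darts sends the weights of all vertices to `x₀`: its product with a
closed dual chain is the sum of the weights times the potential differences. -/
def IsFlow (G : PlaneGraph n D) (ω : Fin n → ℝ) (x₀ : Fin n) (φ : Fin D → ℝ) : Prop :=
  ∀ (N : Fin D → ℝ) (w : Fin n → ℝ),
    (∀ d, w (G.tail (G.rev d)) - w (G.tail d) = N d - N (G.rev d)) →
    ∑ d, N d * φ d = ∑ v, ω v * (w v - w x₀)

/-- The invariant of the computation of the flow: the weights of the darts outside `l` have been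
sent to darts in `l`. -/
structure Flowing (G : PlaneGraph n D) (x₀ : Fin n) (walks : List (List (Fin D))) (ω : Fin n → ℝ)
    (root : Fin D) (l : List (Fin D)) (s : State) : Prop where
  header : Header x₀ walks s
  root_eq : s.v 10 = root
  pre : ∀ i, s.ra 2 i = 0
  length : s.v 12 = l.length
  tree : SearchTree G root (s.a 2) (s.a 3) l
  zero : ∀ d : Fin D, d ∉ l → s.ra 0 d = 0
  -- Conserved quantity: the contribution of the flow recorded so far, plus that of the undelivered
  -- weights at their present vertices.
  balance : ∀ (N : Fin D → ℝ) (w : Fin n → ℝ),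
    (∀ d, w (G.tail (G.rev d)) - w (G.tail d) = N d - N (G.rev d)) →
    ∑ d : Fin D, N d * s.ra 1 d + ∑ d : Fin D, s.ra 0 d * w (G.tail d) = ∑ v, ω v * w v

/-- Move an amount `c` from the entry `d` to the entry `p`. -/
lemma sum_mul_move {f g : Fin D → ℝ} {d p : Fin D} (hdp : d ≠ p) (c : ℝ) (u : Fin D → ℝ)
    (hp : g p = f p + c) (hd : g d = f d - c) (hg : ∀ e, e ≠ d → e ≠ p → g e = f e) :
    ∑ e, u e * g e = ∑ e, u e * f e + c * (u p - u d) := by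
  have h : ∀ e, u e * g e = u e * f e + ((if e = p then c * u e else 0) -
      if e = d then c * u e else 0) := by
    intro e
    by_cases h1 : e = d
    · subst h1
      simp [hdp, hd]
      ring
    · by_cases h2 : e = p
      · subst h2
        simp [h1, hp]
        ring
      · simp [h1, h2, hg]
  rw [sum_congr rfl fun e _ => h e, sum_add_distrib, sum_sub_distrib]
  simp
  ring

/-- The last dart of the queue passes its weight to its parent, which is still in the queue. A
rotation step stays at the same vertex and needs no flow. In a reversal step, the changes of the two
sums in `balance` cancel by the relation between `N` and `w` at `p`. -/
lemma Flowing.step {ω : Fin n → ℝ} {root d p : Fin D} {l : List (Fin D)} {s s' : State}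
    (h : Flowing G x₀ walks ω root (d :: l) s) (hdl : d ∉ l) (hpl : p ∈ l)
    (hdp : d = G.rot p ∨ d = G.rev p) (htree : SearchTree G root (s.a 2) (s.a 3) l)
    (hv : ∀ i < 12, s'.v i = s.v i) (h12 : s'.v 12 = l.length) (ha : s'.a = s.a)
    (h2 : s'.ra 2 = s.ra 2) (h0p : s'.ra 0 p = s.ra 0 p + s.ra 0 d)
    (h0d : s'.ra 0 d = s.ra 0 d - s.ra 0 d)
    (h0 : ∀ e : Fin D, e ≠ d → e ≠ p → s'.ra 0 e = s.ra 0 e)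
    (h1 : (d ≠ G.rev p ∧ s'.ra 1 = s.ra 1) ∨ (d = G.rev p ∧
      s'.ra 1 p = s.ra 1 p + s.ra 0 d ∧ s'.ra 1 d = s.ra 1 d - s.ra 0 d ∧
      ∀ e : Fin D, e ≠ d → e ≠ p → s'.ra 1 e = s.ra 1 e)) :
    Flowing G x₀ walks ω root l s' := by
  have hne : d ≠ p := fun e => hdl (e ▸ hpl)
  refine ⟨h.header.of_eq fun i hi => hv i (by omega), by rw [hv 10 (by norm_num), h.root_eq],
    fun i => by rw [h2, h.pre], h12, by rwa [ha], fun e he => ?_, fun N w hw => ?_⟩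
  · by_cases hed : e = d
    · rw [hed, h0d, sub_self]
    · rw [h0 e hed fun h => he (h ▸ hpl), h.zero e (by simp [hed, he])]
  · have hS := sum_mul_move (f := fun e : Fin D => s.ra 0 e) (g := fun e : Fin D => s'.ra 0 e)
      hne (s.ra 0 d) (fun e => w (G.tail e)) h0p h0d h0
    have hb := h.balance N w hw
    simp only [mul_comm (w _)] at hS
    rcases h1 with ⟨h3, h4⟩ | ⟨h3, h4, h5, h6⟩
    · rw [hdp.resolve_right h3, G.tail_rot, sub_self, mul_zero, add_zero] at hS
      rw [h4, hS, hb]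
    · have hφ := sum_mul_move (f := fun e : Fin D => s.ra 1 e) (g := fun e : Fin D => s'.ra 1 e)
        hne (s.ra 0 d) N h4 h5 h6
      have h7 := hw p
      rw [← h3] at h7
      rw [hφ, hS, ← hb]
      linear_combination (-s.ra 0 d) * h7

lemma wp_flowStep {inR : List ℝ} {ω : Fin n → ℝ} {root d : Fin D} {l : List (Fin D)}
    {s : State} (h : Flowing G x₀ walks ω root (d :: l) s) (hl : l ≠ []) :
    Wp (G.encode x₀ walks) inR (.seq (.block
    [.sub 12 12 1, .load 13 2 12, .load 14 3 13, .rload 0 0 13, .rload 1 0 14, .radd 1 1 0,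
      .rstore 0 14 1, .rload 1 0 13, .rsub 1 1 0, .rstore 0 13 1, .add 15 7 14, .read 15 15])
    (.ifLt 15 13 (.block []) (.ifLt 13 15 (.block []) (.block
      [.rload 1 1 14, .radd 1 1 0, .rstore 1 14 1, .rload 1 1 13, .rsub 1 1 0,
        .rstore 1 13 1])))) s fun t s' => t ≤ 111 ∧ Flowing G x₀ walks ω root l s' := by
  have hs := h.header
  obtain ⟨p, hq, hdl, hpl, hpar, hdp, htree⟩ : ∃ p, s.a 2 l.length = d ∧ d ∉ l ∧ p ∈ l ∧
      s.a 3 d = (p : Fin D) ∧ (d = G.rot p ∨ d = G.rev p) ∧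
      SearchTree G root (s.a 2) (s.a 3) l := by
    rcases h.tree with _ | ⟨h1, h2, h3, h4, h5, h6⟩
    · exact absurd rfl hl
    · exact ⟨_, h1, h2, h3, h4, h5, h6⟩
  have hne : d ≠ p := fun e => hdl (e ▸ hpl)
  have hne' : (d : ℕ) ≠ p := fun e => hne (Fin.ext e)
  have hlen : s.v 12 - 1 = l.length := by rw [h.length]; simp
  refine wp_seq (wp_block fun t₁ ht₁ => ?_)
  simp only [List.length_cons, List.length_nil] at ht₁
  simp only [List.foldl_cons, List.foldl_nil, Op.apply, Function.update_apply]
  simp only [reduceIte, Nat.reduceEqDiff, hs.v1, hlen, hq, hpar, hs.v7, PlaneGraph.encode_rev]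
  have hd0 : Function.update (s.ra 0) (p : ℕ) (s.ra 0 p + s.ra 0 d) d = s.ra 0 d := by
    simp [hne']
  have h0 : ∀ e : Fin D, e ≠ d → e ≠ p → (e : ℕ) ≠ d ∧ (e : ℕ) ≠ p :=
    fun e h1 h2 => ⟨fun h => h1 (Fin.ext h), fun h => h2 (Fin.ext h)⟩
  rw [hd0]
  -- Two strict comparisons decide whether `d = G.rev p`. If `d` is also `G.rot p`, flow is recorded
  -- as for a reversal, which `Flowing.step` permits.
  refine wp_ifLt (fun hlt => wp_block fun t₂ ht₂ => ?_) (fun hlt => wp_ifLt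
    (fun hlt' => wp_block fun t₂ ht₂ => ?_) (fun hlt' => wp_block fun t₂ ht₂ => ?_))
  all_goals
    simp only [List.length_cons, List.length_nil] at ht₂
    refine ⟨by omega, ?_⟩
  · simp at hlt
    refine h.step hdl hpl hdp htree ?_ ?_ rfl ?_ ?_ ?_ ?_ (Or.inl ⟨fun e => ?_, ?_⟩)
    · intro i hi
      simp [show i ≠ 12 by omega, show i ≠ 13 by omega,
        show i ≠ 14 by omega, show i ≠ 15 by omega]
    · simp
    · simp
    · simp [hne'.symm]
    · simp
    · intro e h1 h2
      simp [h0 e h1 h2]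
    · simp [e] at hlt
    · simp
  · simp at hlt'
    refine h.step hdl hpl hdp htree ?_ ?_ rfl ?_ ?_ ?_ ?_ (Or.inl ⟨fun e => ?_, ?_⟩)
    · intro i hi
      simp [show i ≠ 12 by omega, show i ≠ 13 by omega,
        show i ≠ 14 by omega, show i ≠ 15 by omega]
    · simp
    · simp
    · simp [hne'.symm]
    · simp
    · intro e h1 h2
      simp [h0 e h1 h2]
    · simp [e] at hlt'
    · simp
  · simp at hlt hlt'
    have hrev : d = G.rev p := le_antisymm hlt hlt'
    refine h.step hdl hpl hdp htree ?_ ?_ rfl ?_ ?_ ?_ ?_ (Or.inr ⟨hrev, ?_, ?_, ?_⟩)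
    · intro i hi
      simp [Op.apply, Function.update_apply, show i ≠ 12 by omega, show i ≠ 13 by omega,
        show i ≠ 14 by omega, show i ≠ 15 by omega]
    · simp [Op.apply]
    · simp [Op.apply]
    · simp [Op.apply, hne'.symm]
    · simp [Op.apply]
    · intro e h1 h2
      simp [Op.apply, h0 e h1 h2]
    · simp [Op.apply, hne'.symm]
    · simp [Op.apply, hne']
    · intro e h1 h2
      simp [Op.apply, h0 e h1 h2]

lemma wp_flowCmd {inR : List ℝ} {ω : Fin n → ℝ} {first : Fin n → Fin D} {l : List (Fin D)}
    {s₀ : State} (hfirst : ∀ v, G.tail (first v) = v) (h : Header x₀ walks s₀)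
    (h10 : s₀.v 10 = first x₀) (hra : ∀ k i, k ≠ 0 → s₀.ra k i = 0) (hl : ∀ d, d ∈ l)
    (hlen : s₀.v 12 = l.length) (htree : SearchTree G (first x₀) (s₀.a 2) (s₀.a 3) l)
    (hω : ∀ f : Fin D → ℝ, ∑ d : Fin D, s₀.ra 0 d * f d = ∑ v, ω v * f (first v)) :
    Wp (G.encode x₀ walks) inR flowCmd s₀ fun t s => t ≤ 113 * D + 7 ∧ Header x₀ walks s ∧
      s.r 3 = ∑ v, ω v ∧ IsFlow G ω x₀ (fun d => s.ra 1 d) ∧ ∀ i, s.ra 2 i = 0 := by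
  refine wp_seq (wp_whileLt (fun s => ∃ l, Flowing G x₀ walks ω (first x₀) l s)
    (fun s => 113 * s.v 12) ?_ ?_ ?_)
  · rintro s ⟨l, hl⟩ hlt
    rw [hl.header.v1, hl.length] at hlt
    rcases l with _ | ⟨d, l⟩
    · simp at hlt
    · have hne : l ≠ [] := by
        rintro rfl
        simp at hlt
      refine (wp_flowStep hl hne).mono ?_
      rintro t s' ⟨h1, h2⟩
      refine ⟨⟨l, h2⟩, ?_⟩
      have h3 := h2.length
      have h4 := hl.length
      rw [List.length_cons] at h4
      omega
  · refine ⟨l, h, h10, fun i => hra 2 i (by decide), hlen, htree, fun d hd => absurd (hl d) hd,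
      fun N w hw => ?_⟩
    simp [hra 1 _ (by decide), hω, hfirst]
  · rintro t s ht ⟨l', hl'⟩ hlt
    have hle := htree.length_le
    rw [← hlen] at hle
    refine wp_block fun t₁ ht₁ => ?_
    simp only [List.length_cons, List.length_nil] at ht₁
    have h1 : l' = [first x₀] := by
      have h2 := hl'.tree.root_mem
      rw [hl'.header.v1, hl'.length] at hlt
      rcases l' with _ | ⟨d, _ | ⟨e, l'⟩⟩
      · simp at h2
      · rw [List.mem_singleton.1 h2]
      · simp at hlt
    have hS : ∀ u : Fin D → ℝ, ∑ d : Fin D, s.ra 0 d * u d = s.ra 0 (first x₀) * u (first x₀) := by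
      intro u
      refine sum_eq_single _ (fun d _ hd => ?_) (fun h => absurd (mem_univ _) h)
      rw [hl'.zero d (by simpa [h1] using hd), zero_mul]
    -- The balance with `N = 0` and `w = 1` is conservation of the total weight.
    have htot : s.ra 0 (first x₀) = ∑ v, ω v := by
      have := hl'.balance 0 1 (by simp)
      have h3 := hS 1
      simp only [Pi.one_apply, mul_one] at h3
      simpa [h3] using this
    refine ⟨by omega, hl'.header.of_eq fun i _ => rfl, ?_, ?_, hl'.pre⟩
    · simp [Op.apply, hl'.root_eq, htot]
    · intro N w hw
      have := hl'.balance N w hw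
      rw [hS (fun d => w (G.tail d)), htot, hfirst, sum_mul] at this
      simp only [mul_sub, sum_sub_distrib]
      exact eq_sub_of_add_eq this

end Flow

end RealRAM

namespace RealRAM

open Finset

/-! ### Prefix sums of the flow along the walks -/

section Prefix

variable {n D : ℕ} {G : PlaneGraph n D} {x₀ : Fin n} {walks : List (List (Fin D))}

open PlaneGraph (encodeWalks)

/-- The position of the walk `j` in the list that describes the walks. -/
def walkOffset (walks : List (List (Fin D))) (j : ℕ) : ℕ := (encodeWalks (walks.take j)).length

lemma encodeWalks_eq {j : ℕ} (hj : j < walks.length) :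
    encodeWalks walks = encodeWalks (walks.take j) ++
      (((walks.getD j []).length :: (walks.getD j []).map (fun d : Fin D => (d : ℕ))) ++
        encodeWalks (walks.drop (j + 1))) := by
  conv_lhs => rw [← List.take_append_drop j walks, List.drop_eq_getElem_cons hj]
  rw [encodeWalks, List.flatMap_append, List.flatMap_cons, List.getD_eq_getElem _ _ hj]
  rfl

lemma walkOffset_succ {j : ℕ} (hj : j < walks.length) :
    walkOffset walks (j + 1) = walkOffset walks j + 1 + (walks.getD j []).length := by
  rw [walkOffset, walkOffset, List.take_succ_eq_append_getElem hj]
  simp [encodeWalks, hj]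
  omega

lemma walkOffset_mono : Monotone (walkOffset walks) := by
  refine monotone_nat_of_le_succ fun j => ?_
  by_cases hj : j < walks.length
  · rw [walkOffset_succ hj]
    omega
  · rw [walkOffset, walkOffset, List.take_of_length_le (by omega), List.take_of_length_le (by omega)]

lemma getD_encodeWalks_length {j : ℕ} (hj : j < walks.length) :
    (encodeWalks walks).getD (walkOffset walks j) 0 = (walks.getD j []).length := by
  have := PlaneGraph.getD_append_add (L := encodeWalks (walks.take j)) (L' :=
    (((walks.getD j []).length :: (walks.getD j []).map (fun d : Fin D => (d : ℕ))) ++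
        encodeWalks (walks.drop (j + 1)))) rfl 0
  rw [← encodeWalks_eq hj] at this
  exact this

lemma getD_encodeWalks_dart {j i : ℕ} (hj : j < walks.length)
    (hi : i < (walks.getD j []).length) :
    (encodeWalks walks).getD (walkOffset walks j + (1 + i)) 0 = (walks.getD j [])[i] := by
  rw [encodeWalks_eq hj, walkOffset, PlaneGraph.getD_append_add rfl, add_comm 1 i, List.cons_append,
    List.getD_cons_succ, List.getD_append _ _ _ _ (by simpa using hi),
    List.getD_eq_getElem _ _ (by simpa using hi), List.getElem_map]

/-- The sum of `φ` over the first `i` darts of `π`. -/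
def prefixSum (φ : Fin D → ℝ) (π : List (Fin D)) (i : ℕ) : ℝ := ((π.take i).map φ).sum

lemma prefixSum_succ (φ : Fin D → ℝ) {π : List (Fin D)} {i : ℕ} (hi : i < π.length) :
    prefixSum φ π (i + 1) = prefixSum φ π i + φ π[i] := by
  rw [prefixSum, List.take_succ_eq_append_getElem hi, List.map_append, List.sum_append]
  simp [prefixSum]

/-- The memory contents on which the queries rely. -/
structure Ready (ω : Fin n → ℝ) (φ : Fin D → ℝ) (walks : List (List (Fin D))) (s : State) :
    Prop where
  total : s.r 3 = ∑ v, ω v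
  pre : ∀ j < walks.length, ∀ i ≤ (walks.getD j []).length,
    s.ra 2 (s.a 4 j + i) = prefixSum φ (walks.getD j []) i

/-- The invariant of the computation of the prefix sums: the first `i` darts of the walk `j` have
been read. -/
structure Prefixing (x₀ : Fin n) (walks : List (List (Fin D))) (ω : Fin n → ℝ) (φ : Fin D → ℝ)
    (j i : ℕ) (s : State) : Prop where
  header : Header x₀ walks s
  lt : j < walks.length
  le : i ≤ (walks.getD j []).length
  walk : s.v 10 = j
  position : s.v 11 = 4 + D + D + D + walkOffset walks j + 1 + i
  last : s.v 12 = 4 + D + D + D + walkOffset walks j + 1 + (walks.getD j []).length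
  total : s.r 3 = ∑ v, ω v
  flow : ∀ d : Fin D, s.ra 1 d = φ d
  start : ∀ j' ≤ j, s.a 4 j' = 4 + D + D + D + walkOffset walks j' + 1
  pre : ∀ j' ≤ j, ∀ i' ≤ (walks.getD j' []).length, (j' < j ∨ i' ≤ i) →
    s.ra 2 (4 + D + D + D + walkOffset walks j' + 1 + i') = prefixSum φ (walks.getD j' []) i'
  zero : ∀ k > s.v 11, s.ra 2 k = 0

lemma Prefixing.wp_step {inR : List ℝ} {ω : Fin n → ℝ} {φ : Fin D → ℝ} {j i : ℕ} {s : State}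
    (h : Prefixing x₀ walks ω φ j i s) (hi : i < (walks.getD j []).length) :
    Wp (G.encode x₀ walks) inR (.block [.read 13 11, .rload 0 1 13, .rload 1 2 11, .radd 1 1 0,
      .add 11 11 1, .rstore 2 11 1]) s fun t s' => t ≤ 36 ∧ Prefixing x₀ walks ω φ j (i + 1) s' := by
  have hs := h.header
  have hread : (G.encode x₀ walks).getD (s.v 11) 0 = (walks.getD j [])[i] := by
    rw [h.position, ← getD_encodeWalks_dart h.lt hi, ← G.encode_walks x₀ walks]
    simp only [add_assoc]
  have hpre : s.ra 2 (s.v 11) = prefixSum φ (walks.getD j []) i := by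
    rw [h.position]
    exact h.pre j le_rfl i hi.le (Or.inr le_rfl)
  refine wp_block fun t ht => ⟨ht, ?_⟩
  simp only [List.foldl_cons, List.foldl_nil, Op.apply, Function.update_apply]
  simp only [reduceIte, Nat.reduceEqDiff, hs.v1, hread, hpre, h.flow, ← prefixSum_succ φ hi]
  refine ⟨hs.of_eq fun k hk => ?_, h.lt, hi, ?_, ?_, ?_, ?_, ?_, h.start, ?_, ?_⟩
  · simp [show k ≠ 11 by omega, show k ≠ 13 by omega]
  · simp [h.walk]
  · simp only [Function.update_self, h.position]
    rfl
  · simp [h.last]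
  · simp [h.total]
  · intro d
    simp [h.flow]
  · intro j' hj' i' hi' hor
    simp only [Function.update_self, Function.update_apply]
    by_cases heq : j' = j ∧ i' = i + 1
    · obtain ⟨rfl, rfl⟩ := heq
      rw [if_pos (by rw [h.position]; rfl)]
    -- Prefix sums are stored at input positions. A walk with `L` darts needs `L + 1` entries; the
    -- last one is at the position of the next walk's length, so different walks use disjoint
    -- entries.
    · have hne : 4 + D + D + D + walkOffset walks j' + 1 + i' ≠ s.v 11 + 1 := by
        rw [h.position]
        rcases hj'.lt_or_eq with hlt | rfl
        · have h1 := walkOffset_succ (walks := walks) (hlt.trans h.lt)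
          have h2 := walkOffset_mono (walks := walks) (Nat.succ_le_of_lt hlt)
          rw [Nat.succ_eq_add_one, h1] at h2
          omega
        · omega
      rw [if_neg hne]
      exact h.pre j' hj' i' hi' (by omega)
  · intro k hk
    simp only [Function.update_self, Function.update_apply] at hk ⊢
    rw [if_neg (by omega), h.zero k (by omega)]

/-- The invariant of the outer loop. -/
structure Prefixed (x₀ : Fin n) (walks : List (List (Fin D))) (ω : Fin n → ℝ) (φ : Fin D → ℝ)
    (s : State) : Prop where
  header : Header x₀ walks s
  le : s.v 10 ≤ walks.length
  position : s.v 11 = 4 + D + D + D + walkOffset walks (s.v 10)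
  total : s.r 3 = ∑ v, ω v
  flow : ∀ d : Fin D, s.ra 1 d = φ d
  start : ∀ j < s.v 10, s.a 4 j = 4 + D + D + D + walkOffset walks j + 1
  pre : ∀ j < s.v 10, ∀ i ≤ (walks.getD j []).length,
    s.ra 2 (4 + D + D + D + walkOffset walks j + 1 + i) = prefixSum φ (walks.getD j []) i
  zero : ∀ k > s.v 11, s.ra 2 k = 0

lemma Prefixed.wp_prefixWalkCmd {inR : List ℝ} {ω : Fin n → ℝ} {φ : Fin D → ℝ} {s : State}
    (h : Prefixed x₀ walks ω φ s) (hlt : s.v 10 < walks.length) :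
    Wp (G.encode x₀ walks) inR prefixWalkCmd s fun t s' =>
      t ≤ 38 * (walks.getD (s.v 10) []).length + 31 ∧ s'.v 10 = s.v 10 + 1 ∧
        Prefixed x₀ walks ω φ s' := by
  have hs := h.header
  have hread : (G.encode x₀ walks).getD (s.v 11) 0 = (walks.getD (s.v 10) []).length := by
    rw [h.position, G.encode_walks, getD_encodeWalks_length hlt]
  refine wp_seq (wp_block fun t₀ ht₀ => wp_seq ?_)
  simp only [List.length_cons, List.length_nil] at ht₀
  simp only [List.foldl_cons, List.foldl_nil, Op.apply, Function.update_apply]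
  simp only [reduceIte, Nat.reduceEqDiff, hs.v1, hread]
  refine wp_whileLt (fun s' => ∃ i, Prefixing x₀ walks ω φ (s.v 10) i s')
    (fun s' => 38 * (s'.v 12 - s'.v 11)) ?_ ?_ ?_
  · rintro s' ⟨i, hi⟩ hlt'
    rw [hi.position, hi.last] at hlt'
    refine (hi.wp_step (by omega)).mono ?_
    rintro t s'' ⟨ht, h''⟩
    refine ⟨⟨_, h''⟩, ?_⟩
    rw [h''.position, h''.last, hi.position, hi.last]
    omega
  · refine ⟨0, hs.of_eq fun k hk => ?_, hlt, by omega, ?_, ?_, ?_, h.total, h.flow, ?_, ?_, ?_⟩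
    · simp [show k ≠ 11 by omega, show k ≠ 12 by omega]
    · simp
    · simp [h.position]
    · simp [h.position]
    · intro j' hj'
      by_cases heq : j' = s.v 10
      · simp [heq, h.position]
      · simp [heq, h.start j' (by omega)]
    · intro j' hj' i' hi' hor
      rcases hj'.lt_or_eq with hj' | rfl
      · exact h.pre j' hj' i' hi'
      · obtain rfl : i' = 0 := by omega
        -- The empty prefix sum is never written; its entry still holds the initial `0`.
        rw [h.zero _ (by rw [h.position]; omega)]
        simp [prefixSum]
    · intro k hk
      simp at hk
      exact h.zero k (by omega)
  · rintro t₁ s' ht₁ ⟨i, hi⟩ hlt'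
    simp at ht₁
    rw [hi.position, hi.last] at hlt'
    have hle := hi.le
    obtain rfl : i = (walks.getD (s.v 10) []).length := by omega
    refine wp_block fun t₂ ht₂ => ?_
    simp only [List.length_cons, List.length_nil] at ht₂
    simp only [List.foldl_cons, List.foldl_nil, Op.apply, Function.update_self]
    have h10 : s'.v 10 + s'.v 1 = s.v 10 + 1 := by rw [hi.walk, hi.header.v1]
    refine ⟨?_, h10, hi.header.of_eq fun k hk => ?_, ?_, ?_, hi.total, hi.flow, ?_, ?_, ?_⟩
    · simp at hle ⊢
      omega
    · simp [show k ≠ 10 by omega]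
    · simp [h10, hlt]
    · simp [h10, walkOffset_succ hlt, hi.position, add_assoc]
    · simp only [Function.update_self, h10]
      exact fun j hj => hi.start j (by omega)
    · simp only [Function.update_self, h10]
      exact fun j hj i hij => hi.pre j (by omega) i hij (by
        rcases Nat.lt_succ_iff_lt_or_eq.1 hj with hj | rfl
        · exact Or.inl hj
        · exact Or.inr hij)
    · intro k hk
      exact hi.zero k (by simpa using hk)

lemma wp_prefixCmd {inR : List ℝ} {ω : Fin n → ℝ} {s₀ : State} (h : Header x₀ walks s₀)
    (htot : s₀.r 3 = ∑ v, ω v) (hzero : ∀ i, s₀.ra 2 i = 0) :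
    Wp (G.encode x₀ walks) inR prefixCmd s₀ fun t s =>
      t ≤ 13 + (walks.map fun π => 38 * π.length + 33).sum ∧
        Ready ω (fun d => s₀.ra 1 d) walks s := by
  refine wp_seq (wp_block fun t₀ ht₀ => ?_)
  simp only [List.length_cons, List.length_nil] at ht₀
  refine wp_whileLt (Prefixed x₀ walks ω (fun d => s₀.ra 1 d))
    (fun s => ((walks.drop (s.v 10)).map fun π => 38 * π.length + 33).sum) ?_ ?_ ?_
  · intro s hs hlt
    rw [hs.header.v5] at hlt
    refine (hs.wp_prefixWalkCmd hlt).mono ?_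
    rintro t s' ⟨ht, h10, h'⟩
    refine ⟨h', ?_⟩
    rw [h10, List.drop_eq_getElem_cons hlt, List.map_cons, List.sum_cons]
    rw [List.getD_eq_getElem _ _ hlt] at ht
    omega
  · refine ⟨h.of_eq fun k hk => ?_, ?_, ?_, htot, fun d => rfl, ?_, ?_, fun k _ => hzero k⟩
    · simp [Op.apply, show k ≠ 10 by omega, show k ≠ 11 by omega]
    · simp [Op.apply]
    · simp [Op.apply, h.v9, h.v0, walkOffset, encodeWalks]
    · simp [Op.apply]
    · simp [Op.apply]
  · intro t s ht hs hlt
    rw [hs.header.v5] at hlt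
    change t ≤ ((walks.drop 0).map fun π => 38 * π.length + 33).sum + 1 at ht
    rw [List.drop_zero] at ht
    refine ⟨by omega, hs.total, fun j hj i hi => ?_⟩
    rw [hs.start j (by omega), hs.pre j (by omega) i hi]

/-- Walks are nonempty, so the overhead `33` of a walk is charged to one of its arcs: `71 = 38 +
33`. -/
lemma sum_walk_cost_le (hwalks : ∀ π ∈ walks, π ≠ []) :
    (walks.map fun π => 38 * π.length + 33).sum ≤ 71 * (walks.map List.length).sum := by
  induction walks with
  | nil => simp
  | cons π walks ih =>
    have h1 := ih fun π' h => hwalks π' (by simp [h])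
    have h2 := List.length_pos_iff.2 (hwalks π (by simp))
    simp only [List.map_cons, List.sum_cons]
    omega

theorem wp_preprocessCmd (hD : 0 < D) (ω : Fin n → ℝ) (hwalks : ∀ π ∈ walks, π ≠ []) :
    Wp (G.encode x₀ walks) (List.ofFn ω) preprocessCmd Memory.zero.view fun t s =>
      t ≤ 300 * (n + D + (walks.map List.length).sum) ∧
        ∃ φ, IsFlow G ω x₀ φ ∧ Ready ω φ walks s := by
  refine wp_seq (wp_setupCmd.mono ?_)
  rintro t₀ s₀ ⟨ht₀, hs₀, h10, ha₀, hra₀⟩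
  refine wp_ifLt (fun _ => ?_) fun hlt => absurd hD (by rwa [hs₀.v0, hs₀.v3] at hlt)
  refine wp_seq ((wp_firstCmd hD hs₀ h10 ha₀ hra₀).mono ?_)
  rintro t₁ s₁ ⟨ht₁, hs₁, ⟨first, hfirst, hf₁⟩, ha₁, hra₁⟩
  refine wp_seq ((wp_weightCmd hs₁ hf₁ ha₁ hra₁).mono ?_)
  rintro t₂ s₂ ⟨ht₂, hs₂, hf₂, ha₂, hra₂, hω⟩
  refine wp_seq ((wp_searchCmd hs₂ hf₂ ha₂).mono ?_)
  rintro t₃ s₃ ⟨ht₃, hs₃, h10₃, hra₃, l, hl, hlen, htree⟩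
  refine wp_seq ((wp_flowCmd (ω := ω) hfirst hs₃ h10₃ (by rwa [hra₃]) hl hlen htree
    (by rwa [hra₃])).mono ?_)
  rintro t₄ s₄ ⟨ht₄, hs₄, htot, hflow, hzero⟩
  refine (wp_prefixCmd hs₄ htot hzero).mono ?_
  rintro t₅ s₅ ⟨ht₅, hready⟩
  have h1 := sum_walk_cost_le hwalks
  -- Since `n` is positive, it absorbs the additive constants of all phases.
  have h2 := x₀.pos
  exact ⟨by omega, _, hflow, hready⟩

lemma wp_preprocessCmd_of_eq_zero (hD : D = 0) (inR : List ℝ) :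
    Wp (G.encode x₀ walks) inR preprocessCmd Memory.zero.view fun t _ => t ≤ 300 := by
  refine wp_seq (wp_setupCmd.mono ?_)
  rintro t₀ s₀ ⟨ht₀, hs₀, -⟩
  refine wp_ifLt (fun hlt => ?_) fun _ => wp_block fun t ht => ?_
  · rw [hs₀.v0, hs₀.v3, hD] at hlt
    exact absurd hlt (lt_irrefl 0)
  · simp only [List.length_nil] at ht
    omega

end Prefix

/-! ### The query program -/

open Op in
def queryCmd : Cmd := .seq
  (.block [const 0 0, const 1 1, read 2 0, const 3 0, const 4 0, rzero 0])
  (.seq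
    (.whileLt 3 2 (.block [add 4 4 1, read 5 4, load 5 4 5, add 4 4 1, read 6 4, add 6 5 6,
      rload 1 2 6, rsub 0 0 1, add 4 4 1, read 6 4, add 6 5 6, add 6 6 1, rload 1 2 6, radd 0 0 1,
      add 3 3 1]))
    (.block [rsub 0 3 0]))

section Query

variable {n D : ℕ} {walks : List (List (Fin D))}

lemma getD_encode_subpath {q : List Subpath} {j : ℕ} (hj : j < q.length) :
    (Subpath.encode q).getD (3 * j + 1) 0 = q[j].walk ∧
    (Subpath.encode q).getD (3 * j + 1 + 1) 0 = q[j].first ∧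
    (Subpath.encode q).getD (3 * j + 1 + 1 + 1) 0 = q[j].last := by
  simp only [Subpath.encode, List.getD_cons_succ]
  induction q generalizing j with
  | nil => simp at hj
  | cons p q ih =>
    cases j with
    | zero => simp
    | succ j =>
      have := ih (j := j) (by simpa using hj)
      simpa [mul_add, show 3 * j + 3 + 1 = 3 * j + 1 + 3 by omega,
        show 3 * j + 3 + 2 = 3 * j + 2 + 3 by omega] using this

/-- A prefix sum excludes the dart at its index, hence `p.last + 1`; this may be the full length,
which `Ready` includes. -/
lemma prefixSum_sub_prefixSum (φ : Fin D → ℝ) {p : Subpath} (hp : p.Valid walks) :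
    prefixSum φ (walks.getD p.walk []) (p.last + 1) - prefixSum φ (walks.getD p.walk []) p.first =
      ((p.arcs walks).map φ).sum := by
  have h : p.last + 1 = p.first + (p.last + 1 - p.first) := by
    have := hp.1
    omega
  rw [prefixSum, prefixSum, Subpath.arcs]
  conv_lhs => rw [h, List.take_add, List.map_append, List.sum_append]
  ring

lemma Subpath.Valid.walk_lt {p : Subpath} (hp : p.Valid walks) : p.walk < walks.length := by
  by_contra h
  have := hp.2
  rw [List.getD_eq_default _ _ (not_lt.1 h)] at this
  simp at this

theorem wp_queryCmd {inR : List ℝ} {ω : Fin n → ℝ} {φ : Fin D → ℝ} {q : List Subpath} {s₀ : State}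
    (h : Ready ω φ walks s₀) (hq : ∀ p ∈ q, p.Valid walks) :
    Wp (Subpath.encode q) inR queryCmd s₀ fun t s => t ≤ 92 * q.length + 43 ∧ Ready ω φ walks s ∧
      s.r 0 = ∑ v, ω v - ((Subpath.concat walks q).map φ).sum := by
  refine wp_seq (wp_block fun t₀ ht₀ => ?_)
  simp only [List.length_cons, List.length_nil] at ht₀
  refine wp_seq (wp_whileLt (fun s => s.v 1 = 1 ∧ s.v 2 = q.length ∧ s.v 3 ≤ q.length ∧
    s.v 4 = 3 * s.v 3 ∧ Ready ω φ walks s ∧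
      s.r 0 = ((Subpath.concat walks (q.take (s.v 3))).map φ).sum)
    (fun s => 92 * (q.length - s.v 3)) ?_ ?_ ?_)
  · rintro s ⟨h1, h2, h3, h4, h5, h6⟩ hlt
    rw [h2] at hlt
    obtain ⟨hr1, hr2, hr3⟩ := getD_encode_subpath hlt
    have hp := hq _ (List.getElem_mem hlt)
    have hfirst := h5.pre _ (Subpath.Valid.walk_lt hp) _ (hp.1.trans hp.2.le)
    have hlast := h5.pre _ (Subpath.Valid.walk_lt hp) _ hp.2
    rw [Nat.succ_eq_add_one, ← add_assoc] at hlast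
    refine wp_block fun t ht => ?_
    simp only [List.length_cons, List.length_nil] at ht
    simp only [List.foldl_cons, List.foldl_nil, Op.apply, Function.update_apply]
    simp only [reduceIte, Nat.reduceEqDiff, h1, h4, hr1, hr2, hr3, hfirst, hlast]
    refine ⟨⟨?_, ?_, ?_, ?_, ⟨?_, h5.pre⟩, ?_⟩, ?_⟩
    · trivial
    · simp [h2]
    · simpa using hlt
    · rw [mul_add]
    · simp [h5.total]
    · rw [h6, List.take_succ_eq_append_getElem hlt, Subpath.concat, Subpath.concat,
        List.flatMap_append, List.map_append, List.sum_append, List.flatMap_singleton,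
        ← prefixSum_sub_prefixSum φ hp]
      ring
    · omega
  · refine ⟨?_, ?_, ?_, ?_, ⟨h.total, h.pre⟩, ?_⟩ <;> simp [Op.apply, Subpath.encode, Subpath.concat]
  · rintro t s ht ⟨h1, h2, h3, h4, h5, h6⟩ hlt
    rw [h2] at hlt
    refine wp_block fun t₁ ht₁ => ?_
    simp only [List.length_cons, List.length_nil] at ht₁
    refine ⟨by omega, ⟨h5.total, h5.pre⟩, ?_⟩
    simp [Op.apply, h5.total, h6, List.take_of_length_le (not_lt.1 hlt)]

end Query

/-- The flow through a clockwise simple curve is the weight of its exterior. -/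
theorem IsFlow.sum_map {n D : ℕ} {G : PlaneGraph n D} {ω : Fin n → ℝ} {x₀ : Fin n}
    {φ : Fin D → ℝ} (hφ : IsFlow G ω x₀ φ) {γ : List (Fin D)} {pos : Fin γ.length → ℤ}
    (hγ : G.IsClosedDualWalk γ) (hpos : G.IsSimplePerturbation γ pos)
    (hcw : G.IsClockwise γ pos) (hx₀ : x₀ ∈ G.interior γ pos) :
    (γ.map φ).sum = ∑ v, ω v - totalWeight ω (G.interior γ pos) := by
  obtain ⟨w, hw⟩ := G.exists_isPotential hγ
  -- Take for `N d` the number of times that `γ` uses the arc `d`; then `N d - N (G.rev d)` is the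
  -- sum of the crossing signs.
  have h1 := hφ (fun d => ∑ j, if γ.get j = d then 1 else 0) w (fun d => by
    rw [hw d, ← sum_sub_distrib]
    refine sum_congr rfl fun j _ => ?_
    have h : G.rev (γ.get j) = d ↔ γ.get j = G.rev d :=
      ⟨fun h => by rw [← h, G.rev_rev], fun h => by rw [h, G.rev_rev]⟩
    simp only [PlaneGraph.crossSign, h])
  have h2 : ∑ d, (∑ j, if γ.get j = d then (1 : ℝ) else 0) * φ d = (γ.map φ).sum := by
    simp only [sum_mul, ite_mul, one_mul, zero_mul]
    rw [sum_comm]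
    simp
  rw [← h2, h1, totalWeight, ← sum_sub_distrib]
  refine sum_congr rfl fun v _ => ?_
  rw [PlaneGraph.potential_sub_eq_indicator hγ hw hpos hcw hx₀]
  by_cases hv : v ∈ G.interior γ pos <;> simp [hv]

end RealRAM

/-! ### The two programs and their bounds -/

theorem mainTheorem8 :
    ∃ (preprocess query : RealRAM.Program) (C : ℕ),
      ∀ (n D : ℕ) (G : PlaneGraph n D) (ω : Fin n → ℝ) (x₀ : Fin n) (walks : List (List (Fin D))),
        (∀ π ∈ walks, G.IsDualWalk π) →
        ∃ (t : ℕ) (M : RealRAM.Memory) (S : Set RealRAM.Memory),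
          RealRAM.HaltsWithin preprocess (G.encode x₀ walks) (List.ofFn ω) RealRAM.Memory.zero t M ∧
          t ≤ C * (n + D + (walks.map List.length).sum) ∧
          (G.IsSimple → t ≤ C * (n + (walks.map List.length).sum)) ∧
          M ∈ S ∧
          ∀ M₁ ∈ S, ∀ (q : List Subpath) (pos : Fin (Subpath.concat walks q).length → ℤ),
            (∀ p ∈ q, p.Valid walks) →
            G.IsClosedDualWalk (Subpath.concat walks q) →
            G.IsSimplePerturbation (Subpath.concat walks q) pos →
            G.IsClockwise (Subpath.concat walks q) pos →
            x₀ ∈ G.interior (Subpath.concat walks q) pos →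
            ∃ M₂ ∈ S,
              RealRAM.HaltsWithin query (Subpath.encode q) [] M₁ (C * q.length) M₂ ∧
              M₂.real 0 = totalWeight ω (G.interior (Subpath.concat walks q) pos) := by
  -- For simple graphs `D ≤ 6 * n + 4` and `n ≥ 1` give `300 * (n + D) ≤ 2100 * n + 1200 ≤ 3300 *
  -- n`.
  refine ⟨RealRAM.preprocessCmd.compile 0, RealRAM.queryCmd.compile 0, 3300,
    fun n D G ω x₀ walks hwalks => ?_⟩
  have hn := x₀.pos
  rcases Nat.eq_zero_or_pos D with hD | hD
  · obtain ⟨t, M, h1, h2⟩ := (RealRAM.wp_preprocessCmd_of_eq_zero (G := G) (x₀ := x₀)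
      (walks := walks) hD (List.ofFn ω)).exists_haltsWithin
    refine ⟨t, M, Set.univ, h1, by omega, fun _ => by omega, Set.mem_univ _,
      fun M₁ _ q pos _ hγ => ?_⟩
    subst hD
    -- Without edges there is no closed dual walk, hence no query to answer.
    exact absurd (List.eq_nil_iff_forall_not_mem.2 fun d => d.elim0) hγ.1
  · obtain ⟨t, M, h1, h2, φ, hφ, hM⟩ := (RealRAM.wp_preprocessCmd (G := G) (x₀ := x₀) hD ω
      fun π hπ => (hwalks π hπ).1).exists_haltsWithin
    -- A query preserves `Ready`, so this set serves any sequence of queries; the flow `φ` is fixed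
    -- before any query or perturbation is given.
    refine ⟨t, M, {M | RealRAM.Ready ω φ walks M.view}, h1, by omega, fun hG => ?_, hM,
      fun M₁ hM₁ q pos hq hγ hpos hcw hx₀ => ?_⟩
    · have := hG.card_darts_le
      omega
    · obtain ⟨t', M₂, h3, h4, h5, h6⟩ :=
        (RealRAM.wp_queryCmd (inR := []) hM₁ hq).exists_haltsWithin
      refine ⟨M₂, h5, h3.mono ?_, ?_⟩
      -- A closed walk has an arc, so `q.length ≥ 1` absorbs the additive constant of the query.
      · have : q ≠ [] := by
          rintro rfl
          exact hγ.1 rfl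
        have := List.length_pos_iff.2 this
        omega
      · rw [hφ.sum_map hγ hpos hcw hx₀, sub_sub_cancel] at h6
        exact h6
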